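/- A spherical curve is a closed curve on the $2$-sphere with at least one crossing, all of whose crossings are transverse double points; it is considered up to homeomorphism of the sphere. Its regions are the connected components of its complement. A crossing is reducible if there are just three regions around it, and a spherical curve is reducible if it has a reducible crossing. The operation $I$ (the inverse of a half-twisted splice) removes a crossing of a spherical curve by the splice that is not consistent with an orientation of the curve: of the four ends of arcs at the crossing, the two outgoing ones are joined to each other and the two incoming ones are joined to each other, without creating a crossing; the result is again a single closed curve. The reductivity $r(P)$ of a spherical curve $P$ is the minimal number of operations $I$ required to obtain a reducible spherical curve from $P$. For coprime integers $p \ge 2$ and $q \ge 1$, the standard projection $T_{p,q}$ of the $(p,q)$-torus knot is the projection to the sphere, without over/under information, of the closure of the braid $(\sigma_1\sigma_2\cdots\sigma_{p-1})^q$ on $p$ strands; it has $(p-1)q$ crossings. **Proposition.** For every integer $n \ge 1$, $$ r(T_{3,3n-1}) = 2, \qquad r(T_{4,4n-1}) = 2, \qquad r(T_{4,4n+1}) = 3. $$ -/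

import Mathlib

/-- A finite 4-valent map on closed oriented surfaces, given by its rotation system: at every
crossing `v` there are four ends of edges (darts) `(v, 0)`, `(v, 1)`, `(v, 2)`, `(v, 3)`, listed
in counterclockwise order around `v`, and `opp` sends a dart to the other end of its edge. -/
structure FourValentMap where
  Crossing : Type
  [fin : Finite Crossing]
  opp : Crossing × Fin 4 → Crossing × Fin 4
  opp_opp : ∀ d, opp (opp d) = d
  opp_ne : ∀ d, opp d ≠ d

namespace FourValentMap

attribute [instance] FourValentMap.fin

/-- The darts (ends of edges, or edges directed away from a crossing). -/
abbrev Dart (P : FourValentMap) : Type := P.Crossing × Fin 4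

/-- `opp` as a permutation of the darts. -/
def oppPerm (P : FourValentMap) : Equiv.Perm P.Dart :=
  Function.Involutive.toPerm P.opp P.opp_opp

/-- Turn counterclockwise by `k` quarter turns around a crossing. -/
def turn (P : FourValentMap) (k : Fin 4) : Equiv.Perm P.Dart :=
  Equiv.prodCongr (Equiv.refl _) (Equiv.addRight k)

/-- Walk along the curve: follow the edge of an outgoing dart to its other end, and go straight
through the crossing there (the crossing is transverse, so one leaves by the dart
opposite to the one of arrival). -/
def walk (P : FourValentMap) : Equiv.Perm P.Dart := P.oppPerm.trans (P.turn 2)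

/-- Walk along the boundary of the region on the left of a directed edge: follow the edge to its
other end, and leave by the next dart in clockwise order. -/
def boundaryWalk (P : FourValentMap) : Equiv.Perm P.Dart := P.oppPerm.trans (P.turn (-1))

/-- The regions: the cycles of the boundary walk. -/
def Region (P : FourValentMap) : Type := Quotient (Equiv.Perm.SameCycle.setoid P.boundaryWalk)

/-- The region on the left of the outgoing dart `d`; for `d = (v, i)` this is the region at the
corner of `v` between the darts `(v, i)` and `(v, i + 1)`. -/
def regionAt (P : FourValentMap) (d : P.Dart) : P.Region := Quotient.mk _ d

/-- The map is traced by one closed curve: some walk along the curve traverses every edge,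
in one of its two directions. -/
def IsSingleCurve (P : FourValentMap) : Prop :=
  ∃ d : P.Dart, ∀ e : P.Dart, P.walk.SameCycle d e ∨ P.walk.SameCycle d (P.opp e)

/-- Euler's formula `V - E + F = 2`, where `E = 2 V` as every crossing has valency four.
For a connected map it says that the surface is the sphere. -/
def IsPlanar (P : FourValentMap) : Prop :=
  Nat.card P.Region = Nat.card P.Crossing + 2

/-- The two ways to join four darts at a crossing in pairs of neighbours:
`0 - 1, 2 - 3` and `0 - 3, 1 - 2`. -/
def joined (b : Bool) (j : Fin 4) : Fin 4 := if b then 3 - j else 1 - j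

lemma joined_joined (b : Bool) (j : Fin 4) : joined b (joined b j) = j := by
  revert b j; decide

/-- If `d` is a dart at the crossing `v`, pass on from it through `v`, leaving `v` by the joined
dart, along the edge of that dart to its other end. A dart elsewhere stays. -/
noncomputable def pass (P : FourValentMap) (v : P.Crossing) (b : Bool) (d : P.Dart) : P.Dart :=
  open Classical in if d.1 = v then P.opp (v, joined b d.2) else d

lemma pass_of_ne (P : FourValentMap) {v : P.Crossing} (b : Bool) {d : P.Dart} (h : d.1 ≠ v) :
    P.pass v b d = d := by simp [pass, h]

lemma pass_of_eq (P : FourValentMap) {v : P.Crossing} (b : Bool) (j : Fin 4) :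
    P.pass v b (v, j) = P.opp (v, joined b j) := by simp [pass]

/-- The other end of the edge of `d` after the splice at `v`: as an edge can run through the
former crossing `v` at most twice, two passes suffice. -/
noncomputable def spliceOpp (P : FourValentMap) (v : P.Crossing) (b : Bool) (d : P.Dart) :
    P.Dart := P.pass v b (P.pass v b (P.opp d))

lemma spliceOpp_aux (P : FourValentMap) (v : P.Crossing) (b : Bool) (d : P.Dart) (hd : d.1 ≠ v) :
    (P.spliceOpp v b d).1 ≠ v ∧ P.spliceOpp v b (P.spliceOpp v b d) = d ∧
      P.spliceOpp v b d ≠ d := by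
  have inj : Function.Injective P.opp := fun x y h => by
    rw [← P.opp_opp x, h, P.opp_opp]
  have key : ∀ b : Bool, ∀ j k : Fin 4, k ≠ j → k ≠ joined b j →
      ∀ i : Fin 4, i = j ∨ i = joined b j ∨ i = k ∨ i = joined b k := by decide
  have key2 : ∀ b : Bool, ∀ j : Fin 4, joined b j ≠ j := by decide
  by_cases h1 : (P.opp d).1 = v
  · obtain ⟨j, hj⟩ : ∃ j, P.opp d = (v, j) := ⟨(P.opp d).2, Prod.ext h1 rfl⟩
    have hj' : P.opp (v, j) = d := by rw [← hj, P.opp_opp]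
    by_cases h2 : (P.opp (v, joined b j)).1 = v
    · obtain ⟨k, hk⟩ : ∃ k, P.opp (v, joined b j) = (v, k) := ⟨_, Prod.ext h2 rfl⟩
      have hk' : P.opp (v, k) = (v, joined b j) := by rw [← hk, P.opp_opp]
      have hkj : k ≠ j := by
        rintro rfl
        rw [hj'] at hk'
        exact hd (by rw [hk'])
      have hkj' : k ≠ joined b j := by
        rintro rfl
        exact P.opp_ne _ hk
      have h3 : (P.opp (v, joined b k)).1 ≠ v := by
        intro h3
        obtain ⟨i, hi⟩ : ∃ i, P.opp (v, joined b k) = (v, i) := ⟨_, Prod.ext h3 rfl⟩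
        have hi' : P.opp (v, i) = (v, joined b k) := by rw [← hi, P.opp_opp]
        rcases key b j k hkj hkj' i with rfl | rfl | rfl | rfl
        · rw [hj'] at hi'
          exact hd (by rw [hi'])
        · rw [hk] at hi'
          exact key2 b k (congrArg Prod.snd hi').symm
        · rw [hk'] at hi'
          have := congrArg (joined b) (congrArg Prod.snd hi')
          simp only [joined_joined] at this
          exact hkj this.symm
        · exact P.opp_ne _ hi'
      have e1 : P.spliceOpp v b d = P.opp (v, joined b k) := by
        rw [spliceOpp, hj, pass_of_eq, hk, pass_of_eq]
      refine ⟨by rw [e1]; exact h3, ?_, ?_⟩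
      · rw [e1, spliceOpp, P.opp_opp, pass_of_eq, joined_joined, hk', pass_of_eq, joined_joined,
          hj']
      · rw [e1, ← hj']
        intro h
        have := congrArg (joined b) (congrArg Prod.snd (inj h))
        simp only [joined_joined] at this
        exact hkj' this
    · have e1 : P.spliceOpp v b d = P.opp (v, joined b j) := by
        rw [spliceOpp, hj, pass_of_eq, pass_of_ne _ _ h2]
      refine ⟨by rw [e1]; exact h2, ?_, ?_⟩
      · rw [e1, spliceOpp, P.opp_opp, pass_of_eq, joined_joined, hj', pass_of_ne _ _ hd]
      · rw [e1, ← hj']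
        intro h
        exact key2 b j (congrArg Prod.snd (inj h))
  · have e1 : P.spliceOpp v b d = P.opp d := by
      rw [spliceOpp, pass_of_ne _ _ h1, pass_of_ne _ _ h1]
    refine ⟨by rw [e1]; exact h1, ?_, ?_⟩
    · rw [e1, spliceOpp, P.opp_opp, pass_of_ne _ _ hd, pass_of_ne _ _ hd]
    · rw [e1]; exact P.opp_ne d

/-- The splice at `v`: remove the crossing `v` and join its four dangling edge ends in pairs of
neighbours as prescribed by `b`. -/
noncomputable def splice (P : FourValentMap) (v : P.Crossing) (b : Bool) : FourValentMap where
  Crossing := {w : P.Crossing // w ≠ v}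
  opp d := (⟨(P.spliceOpp v b (d.1, d.2)).1, (P.spliceOpp_aux v b (d.1, d.2) d.1.2).1⟩,
    (P.spliceOpp v b (d.1, d.2)).2)
  opp_opp d := by
    obtain ⟨⟨w, hw⟩, j⟩ := d
    have h := (P.spliceOpp_aux v b (w, j) hw).2.1
    ext
    · exact congrArg Prod.fst h
    · exact congrArg (fun x : P.Dart => (x.2 : ℕ)) h
  opp_ne d := by
    obtain ⟨⟨w, hw⟩, j⟩ := d
    have h := (P.spliceOpp_aux v b (w, j) hw).2.2
    intro h'
    exact h (Prod.ext (congrArg (fun x => x.1.1) h') (congrArg (fun x => x.2) h'))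

end FourValentMap

/-- A spherical curve (knot projection) with at least one crossing: a generic closed curve on the
2-sphere, recorded up to homeomorphism by the 4-valent map that it forms on the sphere. -/
structure SphericalCurve extends FourValentMap where
  isSingleCurve : toFourValentMap.IsSingleCurve
  isPlanar : toFourValentMap.IsPlanar

namespace SphericalCurve

open FourValentMap

/-- A crossing is reducible if there are just three regions around it. -/
def IsReducibleCrossing (P : SphericalCurve) (v : P.Crossing) : Prop :=
  (Set.range fun i : Fin 4 => P.regionAt (v, i)).ncard = 3

/-- A spherical curve is reducible if it has a reducible crossing. -/
def IsReducible (P : SphericalCurve) : Prop := ∃ v, P.IsReducibleCrossing v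

/-- The operation `I`, the inverse of a half-twisted splice: `Q` is obtained from `P` by a splice
at a crossing `v` that is incoherent with the orientations of the curve, in that outgoing darts
at `v` are joined to outgoing darts and incoming ones to incoming ones. (The walk along the
curve in a given direction passes through the outgoing darts of that orientation.) -/
def InverseHalfTwistedSplice (P Q : SphericalCurve) : Prop :=
  ∃ (v : P.Crossing) (b : Bool), (∀ j, P.walk.SameCycle (v, j) (v, joined b j)) ∧
    Q.toFourValentMap = P.splice v b

/-- A reducible spherical curve can be obtained from `P` by exactly `k` operations `I`. -/
def ReducibleAfter : ℕ → SphericalCurve → Prop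
  | 0, P => P.IsReducible
  | k + 1, P => ∃ Q, P.InverseHalfTwistedSplice Q ∧ ReducibleAfter k Q

/-- The reductivity: the minimal number of operations `I` that are required to obtain a reducible
spherical curve (`⊤` if there were no such number). -/
noncomputable def reductivity (P : SphericalCurve) : ℕ∞ :=
  ⨅ (k : ℕ) (_ : ReducibleAfter k P), (k : ℕ∞)

end SphericalCurve

/-! ### The standard projections of torus knots -/

namespace TorusProjection

/-- The edges of the closure of the braid `(σ₁ σ₂ ⋯ σₘ) ^ q` on `m + 1` strands, drawn upwards.
The crossing `(j, i)` is the crossing of the columns `i` and `i + 1` in the `j`-th factor, the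
columns being numbered from `0` to `m`. Its darts are numbered counterclockwise:
`0` bottom left, `1` bottom right, `2` top right, `3` top left. -/
def opp (m q : ℕ) : (ZMod q × Fin m) × Fin 4 → (ZMod q × Fin m) × Fin 4
  | ((j, i), 0) =>
      if h : i.1 = 0 then ((j - 1, i), 3)
      else ((j, ⟨i.1 - 1, by omega⟩), 2)
  | ((j, i), 1) =>
      if h : i.1 + 1 < m then ((j - 1, ⟨i.1 + 1, h⟩), 3)
      else ((j - 1, i), 2)
  | ((j, i), 2) =>
      if h : i.1 + 1 < m then ((j, ⟨i.1 + 1, h⟩), 0)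
      else ((j + 1, i), 1)
  | ((j, i), 3) =>
      if h : i.1 = 0 then ((j + 1, i), 0)
      else ((j + 1, ⟨i.1 - 1, by omega⟩), 1)

lemma opp_opp (m q : ℕ) (d : (ZMod q × Fin m) × Fin 4) : opp m q (opp m q d) = d := by
  obtain ⟨⟨j, i, hi⟩, k⟩ := d
  fin_cases k
  · by_cases h : i = 0
    · simp [opp, h]
    · have h' : i - 1 + 1 = i := by omega
      simp [opp, h, h', hi]
  · by_cases h : i + 1 < m <;> simp [opp, h]
  · by_cases h : i + 1 < m <;> simp [opp, h]
  · by_cases h : i = 0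
    · simp [opp, h]
    · have h' : i - 1 + 1 = i := by omega
      simp [opp, h, h', hi]

lemma opp_ne (m q : ℕ) (d : (ZMod q × Fin m) × Fin 4) : opp m q d ≠ d := by
  obtain ⟨⟨j, i, hi⟩, k⟩ := d
  fin_cases k
  · by_cases h : i = 0 <;> simp [opp, h]
  · by_cases h : i + 1 < m <;> simp [opp, h]
  · by_cases h : i + 1 < m <;> simp [opp, h]
  · by_cases h : i = 0 <;> simp [opp, h]

/-- The 4-valent map formed by the closure of `(σ₁ σ₂ ⋯ σₘ) ^ q` without the over/under
information. -/
def closedBraidMap (m q : ℕ) [NeZero q] : FourValentMap where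
  Crossing := ZMod q × Fin m
  opp := opp m q
  opp_opp := opp_opp m q
  opp_ne := opp_ne m q

section SingleCurve

open FourValentMap

variable {m q : ℕ} [NeZero q]

/-- The walk along the closed braid. -/
def strandWalk (m q : ℕ) [NeZero q] : Equiv.Perm ((ZMod q × Fin m) × Fin 4) :=
  (closedBraidMap m q).walk

lemma sameCycle_walk {j j' : ZMod q} {i i' : Fin m} {k k' : Fin 4}
    (h : opp m q ((j, i), k) = ((j', i'), k' + 2)) :
    (strandWalk m q).SameCycle ((j, i), k) ((j', i'), k') := by
  have e : (strandWalk m q) ((j, i), k) = ((j', i'), k') := by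
    change ((opp m q ((j, i), k)).1, (opp m q ((j, i), k)).2 + 2) = _
    rw [h]
    have : ∀ k : Fin 4, k + 2 + 2 = k := by decide
    simp [this]
  exact ⟨1, by simpa using e⟩

lemma sameCycle_right (j : ZMod q) (i : ℕ) (hi : i < m) :
    (strandWalk m q).SameCycle ((j, ⟨0, by omega⟩), 2) ((j, ⟨i, hi⟩), 2) := by
  induction i with
  | zero => exact Equiv.Perm.SameCycle.refl _ _
  | succ i ih =>
    exact (ih (by omega)).trans (sameCycle_walk (by simp [opp, hi]))

lemma sameCycle_left (j : ZMod q) (i : ℕ) (hi : i < m) :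
    (strandWalk m q).SameCycle ((j - i, ⟨i, hi⟩), 3) ((j, ⟨0, by omega⟩), 3) := by
  induction i with
  | zero => simpa using Equiv.Perm.SameCycle.refl _ _
  | succ i ih =>
    refine Equiv.Perm.SameCycle.trans (sameCycle_walk ?_) (ih (by omega))
    have : j - (i + 1) + 1 = j - i := by ring
    simp [opp, this]

lemma sameCycle_turnBack (j : ZMod q) (hm : 0 < m) :
    (strandWalk m q).SameCycle ((j, ⟨0, hm⟩), 2) ((j + 1, ⟨m - 1, by omega⟩), 3) := by
  refine (sameCycle_right j (m - 1) (by omega)).trans (sameCycle_walk ?_)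
  have : ¬ (m - 1 + 1 < m) := by omega
  simp [opp, this]

lemma sameCycle_period (j : ZMod q) (hm : 0 < m) :
    (strandWalk m q).SameCycle ((j, ⟨0, hm⟩), 2) ((j + (m + 1 : ℕ), ⟨0, hm⟩), 2) := by
  have h1 := sameCycle_left (q := q) (j + m) (m - 1) (by omega : m - 1 < m)
  have e : j + (m : ZMod q) - ((m - 1 : ℕ) : ZMod q) = j + 1 := by
    rw [Nat.cast_sub (by omega)]; push_cast; ring
  rw [e] at h1
  refine ((sameCycle_turnBack j hm).trans h1).trans (sameCycle_walk ?_)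
  have : j + (m : ZMod q) + 1 = j + (m + 1) := by ring
  simp [opp, this]

lemma sameCycle_row (j : ZMod q) (hm : 0 < m) (h : (m + 1).Coprime q) :
    (strandWalk m q).SameCycle ((0, ⟨0, hm⟩), 2) ((j, ⟨0, hm⟩), 2) := by
  have h1 : ∀ t : ℕ, (strandWalk m q).SameCycle ((0, ⟨0, hm⟩), 2)
      (((t * (m + 1 : ℕ) : ZMod q), ⟨0, hm⟩), 2) := by
    intro t
    induction t with
    | zero => simpa using Equiv.Perm.SameCycle.refl _ _
    | succ t ih =>
      have e : ((t + 1 : ℕ) * (m + 1 : ℕ) : ZMod q) = t * (m + 1 : ℕ) + (m + 1 : ℕ) := by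
        push_cast; ring
      rw [e]
      exact ih.trans (sameCycle_period _ hm)
  have h2 := h1 (j * ((m + 1 : ℕ) : ZMod q)⁻¹).val
  rwa [ZMod.natCast_zmod_val, mul_assoc, mul_comm _⁻¹, ZMod.coe_mul_inv_eq_one _ h, mul_one] at h2

lemma closedBraidMap_isSingleCurve (hm : 0 < m) (h : (m + 1).Coprime q) :
    (closedBraidMap m q).IsSingleCurve := by
  have h2 : ∀ (j : ZMod q) (i : Fin m),
      (strandWalk m q).SameCycle ((0, ⟨0, hm⟩), 2) ((j, i), 2) := fun j i =>
    (sameCycle_row j hm h).trans (sameCycle_right j i.1 i.2)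
  have h3 : ∀ (j : ZMod q) (i : Fin m),
      (strandWalk m q).SameCycle ((0, ⟨0, hm⟩), 2) ((j, i), 3) := by
    intro j i
    have e := sameCycle_left (q := q) (j + i.1) i.1 i.2
    rw [add_sub_cancel_right] at e
    refine Equiv.Perm.SameCycle.trans ?_ e.symm
    have e2 : (strandWalk m q).SameCycle ((j + i.1, ⟨0, hm⟩), 3)
        ((j + i.1 + 1, ⟨0, hm⟩), 2) := sameCycle_walk (by simp [opp])
    exact (h2 _ _).trans e2.symm
  suffices main : ∀ e : (ZMod q × Fin m) × Fin 4,
      (strandWalk m q).SameCycle ((0, ⟨0, hm⟩), 2) e ∨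
        (strandWalk m q).SameCycle ((0, ⟨0, hm⟩), 2) (opp m q e) from ⟨((0, ⟨0, hm⟩), 2), main⟩
  rintro ⟨⟨j, i⟩, k⟩
  fin_cases k
  · right
    change (strandWalk m q).SameCycle _ (opp m q ((j, i), 0))
    by_cases hi : i.1 = 0
    · simpa [opp, hi] using h3 _ _
    · simpa [opp, hi] using h2 _ _
  · right
    change (strandWalk m q).SameCycle _ (opp m q ((j, i), 1))
    by_cases hi : i.1 + 1 < m
    · simpa [opp, hi] using h3 _ _
    · simpa [opp, hi] using h2 _ _
  · exact Or.inl (h2 j i)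
  · exact Or.inl (h3 j i)

end SingleCurve

section Planar

open FourValentMap

variable {m q : ℕ}

/-- The regions of the closed braid: one above each crossing, the innermost one, on the left of
all columns (`Sum.inr false`), and the outermost one, on the right (`Sum.inr true`). -/
def regionLabel (m q : ℕ) : (ZMod q × Fin m) × Fin 4 → (ZMod q × Fin m) ⊕ Bool
  | ((j, i), 0) => Sum.inl (j - 1, i)
  | ((j, i), 1) => if h : i.1 + 1 < m then Sum.inl (j - 1, ⟨i.1 + 1, h⟩) else Sum.inr true
  | ((j, i), 2) => Sum.inl (j, i)
  | ((j, i), 3) => if i.1 = 0 then Sum.inr false else Sum.inl (j, ⟨i.1 - 1, by omega⟩)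

/-- The boundary walk of the closed braid. -/
def rimWalk (m q : ℕ) [NeZero q] : Equiv.Perm ((ZMod q × Fin m) × Fin 4) :=
  (closedBraidMap m q).boundaryWalk

lemma boundaryWalk_apply [NeZero q] (d : (ZMod q × Fin m) × Fin 4) :
    (rimWalk m q) d = ((opp m q d).1, (opp m q d).2 + -1) := rfl

lemma regionLabel_boundaryWalk [NeZero q] (d : (ZMod q × Fin m) × Fin 4) :
    regionLabel m q ((rimWalk m q) d) = regionLabel m q d := by
  obtain ⟨⟨j, i, hi⟩, k⟩ := d
  rw [boundaryWalk_apply]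
  have a0 : (0 : Fin 4) + -1 = 3 := by decide
  have a1 : (1 : Fin 4) + -1 = 0 := by decide
  have a2 : (2 : Fin 4) + -1 = 1 := by decide
  have a3 : (3 : Fin 4) + -1 = 2 := by decide
  fin_cases k
  · by_cases h : i = 0
    · simp only [opp, h, regionLabel, dite_true, a3]
    · have h' : i - 1 + 1 = i := by omega
      simp [opp, h, regionLabel, a2, h', hi]
  · by_cases h : i + 1 < m
    · simp [opp, h, regionLabel, a3]
    · simp [opp, h, regionLabel, a2]
  · by_cases h : i + 1 < m
    · simp [opp, h, regionLabel, a0]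
    · simp [opp, h, regionLabel, a1]
  · by_cases h : i = 0
    · simp [opp, h, regionLabel, a0]
    · simp [opp, h, regionLabel, a1]

lemma sameCycle_boundary [NeZero q] {j j' : ZMod q} {i i' : Fin m} {k k' : Fin 4}
    (h : opp m q ((j, i), k) = ((j', i'), k' + 1)) :
    (rimWalk m q).SameCycle ((j, i), k) ((j', i'), k') := by
  have e : (rimWalk m q) ((j, i), k) = ((j', i'), k') := by
    rw [boundaryWalk_apply, h]
    have : ∀ k : Fin 4, k + 1 + -1 = k := by decide
    simp [this]
  exact ⟨1, by simpa using e⟩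

/-- A dart on the boundary of the region with a given label. -/
def regionDart (m q : ℕ) (hm : 0 < m) : (ZMod q × Fin m) ⊕ Bool → (ZMod q × Fin m) × Fin 4
  | Sum.inl c => (c, 2)
  | Sum.inr false => ((0, ⟨0, hm⟩), 3)
  | Sum.inr true => ((0, ⟨m - 1, by omega⟩), 1)

lemma regionLabel_regionDart (hm : 0 < m) (x : (ZMod q × Fin m) ⊕ Bool) :
    regionLabel m q (regionDart m q hm x) = x := by
  have : ¬ (m - 1 + 1 < m) := by omega
  rcases x with ⟨j, i⟩ | _ | _ <;> simp [regionLabel, regionDart, this]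

lemma sameCycle_inner [NeZero q] (j : ZMod q) (hm : 0 < m) :
    (rimWalk m q).SameCycle ((0, ⟨0, hm⟩), 3) ((j, ⟨0, hm⟩), 3) := by
  have h : ∀ t : ℕ, (rimWalk m q).SameCycle ((0, ⟨0, hm⟩), 3)
      (((t : ZMod q), ⟨0, hm⟩), 3) := by
    intro t
    induction t with
    | zero => simpa using Equiv.Perm.SameCycle.refl _ _
    | succ t ih => exact ih.trans (sameCycle_boundary (by simp [opp]))
  simpa using h j.val

lemma sameCycle_outer [NeZero q] (j : ZMod q) (hm : 0 < m) :
    (rimWalk m q).SameCycle ((0, ⟨m - 1, by omega⟩), 1)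
      ((j, ⟨m - 1, by omega⟩), 1) := by
  have h0 : ¬ (m - 1 + 1 < m) := by omega
  have h : ∀ t : ℕ, (rimWalk m q).SameCycle (((t : ZMod q), ⟨m - 1, by omega⟩), 1)
      ((0, ⟨m - 1, by omega⟩), 1) := by
    intro t
    induction t with
    | zero => simpa using Equiv.Perm.SameCycle.refl _ _
    | succ t ih =>
      refine Equiv.Perm.SameCycle.trans (sameCycle_boundary ?_) ih
      simp [opp, h0]
  simpa using (h j.val).symm

lemma sameCycle_regionDart [NeZero q] (hm : 0 < m) (d : (ZMod q × Fin m) × Fin 4) :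
    (rimWalk m q).SameCycle (regionDart m q hm (regionLabel m q d)) d := by
  have hL : ∀ (j : ZMod q) (i : ℕ) (hi : i + 1 < m),
      (rimWalk m q).SameCycle ((j, ⟨i, by omega⟩), 2)
        ((j, ⟨i + 1, hi⟩), 3) := fun j i hi =>
    sameCycle_boundary (by simp [opp, hi])
  have hR : ∀ (j : ZMod q) (i : ℕ) (hi : i + 1 < m),
      (rimWalk m q).SameCycle ((j + 1, ⟨i, by omega⟩), 1)
        ((j, ⟨i + 1, hi⟩), 2) := fun j i hi =>
    sameCycle_boundary (by simp [opp, hi])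
  have hB : ∀ (j : ZMod q) (i : ℕ) (hi : i < m),
      (rimWalk m q).SameCycle ((j, ⟨i, hi⟩), 2) ((j + 1, ⟨i, hi⟩), 0) := by
    intro j i hi
    by_cases h : i + 1 < m
    · exact (hL j i h).trans (sameCycle_boundary (by simp [opp]))
    · exact sameCycle_boundary (by simp [opp, h])
  obtain ⟨⟨j, i, hi⟩, k⟩ := d
  fin_cases k
  · simpa [regionLabel, regionDart] using hB (j - 1) i hi
  · by_cases h : i + 1 < m
    · simpa [regionLabel, regionDart, h] using (hR (j - 1) i h).symm
    · obtain rfl : i = m - 1 := by omega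
      simpa [regionLabel, regionDart, h] using sameCycle_outer j hm
  · exact Equiv.Perm.SameCycle.refl _ _
  · by_cases h : i = 0
    · subst h
      simpa [regionLabel, regionDart] using sameCycle_inner j hm
    · obtain ⟨i, rfl⟩ := Nat.exists_eq_succ_of_ne_zero h
      simpa [regionLabel, regionDart] using hL j i hi

lemma closedBraidMap_isPlanar [NeZero q] (hm : 0 < m) : (closedBraidMap m q).IsPlanar := by
  have hz : ∀ (n : ℤ) (d : (ZMod q × Fin m) × Fin 4),
      regionLabel m q (((rimWalk m q) ^ n) d) = regionLabel m q d := by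
    intro n
    induction n with
    | zero => intro d; rfl
    | succ n ih =>
      intro d
      rw [zpow_add_one, Equiv.Perm.mul_apply, ih]
      exact regionLabel_boundaryWalk d
    | pred n ih =>
      intro d
      rw [zpow_sub_one, Equiv.Perm.mul_apply, ih]
      have := regionLabel_boundaryWalk ((rimWalk m q)⁻¹ d)
      rw [← this]
      exact congrArg _ ((rimWalk m q).apply_symm_apply d)
  let e : (closedBraidMap m q).Region ≃ (ZMod q × Fin m) ⊕ Bool :=
    { toFun := Quotient.lift (regionLabel m q) (by
        rintro a b ⟨n, rfl⟩
        exact (hz n a).symm)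
      invFun := fun x => (closedBraidMap m q).regionAt (regionDart m q hm x)
      left_inv := by
        intro r
        induction r using Quotient.inductionOn with
        | h d => exact Quotient.sound (sameCycle_regionDart hm d)
      right_inv := fun x => regionLabel_regionDart hm x }
  have h1 : Nat.card (closedBraidMap m q).Region = Nat.card (ZMod q × Fin m) + 2 := by
    rw [Nat.card_congr e, Nat.card_sum]
    simp
  exact h1

end Planar

end TorusProjection

/-- The standard projection of the `(p, q)`-torus knot: the closure of the braid
`(σ₁ σ₂ ⋯ σ₍ₚ₋₁₎) ^ q` on `p` strands, with `(p - 1) q` crossings. -/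
def torusKnotProjection (p q : ℕ) (hp : 2 ≤ p) (hq : 1 ≤ q) (h : p.Coprime q) : SphericalCurve :=
  haveI : NeZero q := ⟨by omega⟩
  { toFourValentMap := TorusProjection.closedBraidMap (p - 1) q
    isSingleCurve := TorusProjection.closedBraidMap_isSingleCurve (by omega)
      (by rwa [Nat.sub_add_cancel (by omega)])
    isPlanar := TorusProjection.closedBraidMap_isPlanar (by omega) }

lemma coprime_mul_sub_one {k n : ℕ} (hk : 1 ≤ k) (hn : 1 ≤ n) : k.Coprime (k * n - 1) := by
  have h : 1 ≤ k * n := Nat.mul_pos hk hn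
  have h1 : (k * n).Coprime (k * n - 1) := by
    have := (Nat.coprime_self_add_left (m := k * n - 1) (n := 1)).2 (Nat.coprime_one_left _)
    rwa [Nat.sub_add_cancel h] at this
  exact h1.coprime_dvd_left (Dvd.intro _ rfl)

lemma coprime_mul_add_one (k n : ℕ) : k.Coprime (k * n + 1) := by
  simp

/-!
The arguments work with functions of the darts of a curve, with values in `ZMod 2`, that take the
same value at both ends of an edge.

**Interlacement.** A crossing `v` divides the curve into two loops. The indicator of one of them, a
*lobe* at `v`, is characterized among the functions of edges by switching its value at the two
passages through `v` and at no others; it is unique up to adding the constant `1`, because a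
function of edges that never switches is constant on a single curve. Two crossings `v` and `u` are
interlaced if each of the loops at `v` passes once through `u`, that is, if a lobe at `v` takes
different values on the two strands at `u`.

**Reducible crossings.** A single curve lies on the sphere if and only if every cycle modulo `2` is
the boundary of a set of regions (`isPlanar_iff_isExact`, a count of dimensions). With this
description of planarity, a crossing is reducible if and only if it is interlaced with no other one
(`ncard_regionAt_eq_three_iff`): the corners of the two loops at `v` always belong to regions that
occur only once around `v`, and the other two corners belong to the same region if and only if the
loops do not meet again.

**The operation `I`.** The splice at `v` is incoherent if and only if it joins the two loops at `v`
(`IsLobe.incoherent_iff`). It is again a single curve on the sphere, and a lobe at `w` after the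
splice is the lobe at `w` before it, plus the lobe at `v` if `v` and `w` are interlaced. Hence the
operation `I` changes the interlacement graph by local complementation at `v` and removal of `v`,
and the reductivity is the least number of such steps that produce an isolated vertex
(`SphericalCurve.reductivity_eq`).

**Lower bounds.** If `k` steps produce an isolated vertex, then there is a nonempty set `X` of at
most `k + 1` crossings such that every other crossing is interlaced with an even number of elements
of `X`, and if `X` has `k + 1 > 1` elements, then each of them is interlaced with another one
(`IsolatedAfter.exists_finset`). The sum of the lobes at the elements of `X` divides the edges into
two parts that meet only at `X`. The projections on three and four strands are so well connected
that there is no such `X` with at most two elements, except for the `(3, 2)`-torus knot, and that on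
four strands such an `X` with three elements consists of the corners of a triangular region. For
`q = 4 n + 1` the middle corner of each triangle is interlaced with neither of the others, so that
two steps do not suffice.

**Upper bounds.** The curve passes through the crossings of the closed braid at explicit times,
from which the interlacement can be read off. For `q = 3 n - 1` and `q = 4 n - 1`, the corners of
a triangle form a path in the interlacement graph, and two steps at the first and second vertex of
the path isolate the third one. For `q = 4 n + 1`, a step at a suitable crossing first turns the
corners of a triangle into such a path.
-/

/-! ### Labels of the edges of a single curve -/

namespace FourValentMap

variable {P : FourValentMap}

lemma opp_injective : Function.Injective P.opp := P.oppPerm.injective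

lemma walk_apply (d : P.Dart) : P.walk d = ((P.opp d).1, (P.opp d).2 + 2) := rfl

lemma boundaryWalk_apply (d : P.Dart) :
    P.boundaryWalk d = ((P.opp d).1, (P.opp d).2 + -1) := rfl

lemma boundaryWalk_opp (v : P.Crossing) (i : Fin 4) :
    P.boundaryWalk (P.opp (v, i)) = (v, i + -1) := by
  rw [boundaryWalk_apply, P.opp_opp]

lemma eq_of_sameCycle {D α : Type*} {σ : Equiv.Perm D} {c : D → α} (h : ∀ d, c (σ d) = c d)
    {d e : D} (hde : σ.SameCycle d e) : c d = c e := by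
  obtain ⟨n, rfl⟩ := hde
  induction n with
  | zero => rfl
  | succ n ih =>
    rw [add_comm, zpow_add, Equiv.Perm.mul_apply, zpow_one, h]; exact ih
  | pred n ih =>
    have := h ((σ ^ (-(n : ℤ) - 1)) d)
    rw [← Equiv.Perm.mul_apply, ← zpow_one_add] at this
    rw [ih, ← this]
    congr 3; ring

/-- A label of edges that is kept at every straight passage through a crossing is constant on
a single curve. -/
lemma IsSingleCurve.eq_of_straight {α : Type*} (hP : P.IsSingleCurve) {c : P.Dart → α}
    (hopp : ∀ d, c (P.opp d) = c d) (hstr : ∀ v i, c (v, i + 2) = c (v, i)) (d e : P.Dart) :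
    c d = c e := by
  have hw : ∀ d, c (P.walk d) = c d := fun d => by
    rw [walk_apply, hstr]; exact hopp d
  obtain ⟨d₀, h₀⟩ := hP
  have h : ∀ e, c d₀ = c e := fun e => by
    rcases h₀ e with h | h
    · exact eq_of_sameCycle hw h
    · rw [eq_of_sameCycle hw h, hopp]
  rw [← h d, ← h e]

/-- Conversely, to see that a map is traced by a single curve it suffices to test two-valued
labels. -/
lemma isSingleCurve_of_forall_eq [Nonempty P.Crossing]
    (h : ∀ c : P.Dart → Prop, (∀ d, c (P.opp d) = c d) → (∀ v i, c (v, i + 2) = c (v, i)) →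
      ∀ d e, c d = c e) : P.IsSingleCurve := by
  obtain ⟨v⟩ := ‹Nonempty P.Crossing›
  have hw : ∀ d : P.Dart, P.walk.SameCycle (P.opp (P.walk d)) (P.opp d) := fun d => by
    refine ⟨1, ?_⟩
    have h4 : ∀ k : Fin 4, k + 2 + 2 = k := by decide
    rw [zpow_one, walk_apply, P.opp_opp, walk_apply]
    simp only [h4]
  refine ⟨(v, 0), fun e => ?_⟩
  have := h (fun e => P.walk.SameCycle (v, 0) e ∨ P.walk.SameCycle (v, 0) (P.opp e))
    (fun d => by rw [P.opp_opp]; exact propext or_comm)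
    (fun u i => by
      have e1 : P.walk (P.opp (u, i)) = (u, i + 2) := by rw [walk_apply, P.opp_opp]
      have h1 : P.walk.SameCycle (P.opp (u, i)) (u, i + 2) := ⟨1, by rw [zpow_one, e1]⟩
      have h2 := hw (P.opp (u, i))
      rw [P.opp_opp, e1] at h2
      refine propext ⟨?_, ?_⟩
      · rintro (h | h)
        · exact Or.inr (h.trans h1.symm)
        · exact Or.inl (h.trans h2)
      · rintro (h | h)
        · exact Or.inr (h.trans h2.symm)
        · exact Or.inl (h.trans h1))
    (v, 0) e
  exact this ▸ Or.inl (Equiv.Perm.SameCycle.refl _ _)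

/-! ### Orientations -/

/-- The two directions of a single curve: `o` tells for each dart whether the curve, in a fixed
direction, leaves its crossing by it. -/
structure IsOrientation (o : P.Dart → ZMod 2) : Prop where
  opp : ∀ d, o (P.opp d) = o d + 1
  turn : ∀ v i, o (v, i + 2) = o (v, i) + 1
  sameCycle : ∀ d e, o d = o e → P.walk.SameCycle d e

lemma IsOrientation.walk {o : P.Dart → ZMod 2} (ho : P.IsOrientation o) (d : P.Dart) :
    o (P.walk d) = o d := by
  have : ∀ x : ZMod 2, x + 1 + 1 = x := by decide
  rw [walk_apply, ho.turn]
  change o (P.opp d) + 1 = _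
  rw [ho.opp, this]

lemma IsOrientation.eq {o : P.Dart → ZMod 2} (ho : P.IsOrientation o) {d e : P.Dart}
    (h : P.walk.SameCycle d e) : o d = o e := eq_of_sameCycle ho.walk h

lemma walk_symm_opp (d : P.Dart) : P.walk⁻¹ (P.opp d) = P.opp (P.walk d) := by
  rw [Equiv.Perm.inv_eq_iff_eq, walk_apply, P.opp_opp, walk_apply]
  have h4 : ∀ k : Fin 4, k + 2 + 2 = k := by decide
  simp only [h4]

lemma zpow_walk_opp (n : ℤ) (d : P.Dart) :
    (P.walk ^ (-n)) (P.opp d) = P.opp ((P.walk ^ n) d) := by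
  have h1 : P.walk⁻¹ * P.oppPerm = P.oppPerm * P.walk := Equiv.ext walk_symm_opp
  have h2 : SemiconjBy P.oppPerm P.walk P.walk⁻¹ := h1.symm
  have h3 := h2.zpow_right n
  rw [inv_zpow, ← zpow_neg] at h3
  exact (congrArg (fun σ : Equiv.Perm P.Dart => σ d) h3).symm

/-- The two directions of a dart never belong to the same walk: the reversal of the walk would
otherwise fix an edge or a crossing with the strand through it. -/
lemma not_sameCycle_opp (d : P.Dart) : ¬ P.walk.SameCycle d (P.opp d) := by
  rintro ⟨n, hn⟩
  obtain ⟨k, rfl | rfl⟩ := Int.even_or_odd' n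
  · have h := zpow_walk_opp k d
    rw [← hn, ← Equiv.Perm.mul_apply, ← zpow_add] at h
    have e : -k + 2 * k = k := by ring
    rw [e] at h
    exact P.opp_ne _ h.symm
  · have h := zpow_walk_opp k d
    rw [← hn, ← Equiv.Perm.mul_apply, ← zpow_add] at h
    have e : -k + (2 * k + 1) = 1 + k := by ring
    rw [e, zpow_one_add, Equiv.Perm.mul_apply, walk_apply] at h
    have h2 := congrArg Prod.snd h
    have h4 : ∀ k : Fin 4, k + 2 ≠ k := by decide
    exact h4 _ h2

lemma IsSingleCurve.exists_isOrientation (hP : P.IsSingleCurve) :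
    ∃ o : P.Dart → ZMod 2, P.IsOrientation o := by
  classical
  obtain ⟨d₀, h₀⟩ := hP
  have hopp : ∀ {d e : P.Dart}, P.walk.SameCycle d e → P.walk.SameCycle (P.opp d) (P.opp e) := by
    rintro d e ⟨n, rfl⟩
    exact ⟨-n, zpow_walk_opp n d⟩
  have hiff : ∀ d, P.walk.SameCycle d₀ (P.opp d) ↔ ¬ P.walk.SameCycle d₀ d := fun d =>
    ⟨fun h h' => not_sameCycle_opp d (h'.symm.trans h), fun h => (h₀ d).resolve_left h⟩
  have hw : ∀ d, P.walk.SameCycle d₀ (P.walk d) ↔ P.walk.SameCycle d₀ d := fun d =>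
    Equiv.Perm.sameCycle_apply_right
  refine ⟨fun d => if P.walk.SameCycle d₀ d then 1 else 0, fun d => ?_, fun v i => ?_,
    fun d e h => ?_⟩
  · by_cases h : P.walk.SameCycle d₀ d
    · simp only [hiff, h, not_true, if_true, if_false]; decide
    · simp [hiff, h]
  · have h1 := hw (P.opp (v, i))
    rw [walk_apply, P.opp_opp, hiff] at h1
    by_cases h : P.walk.SameCycle d₀ (v, i)
    · simp only [h1, h, not_true, if_true, if_false]; decide
    · simp [h1, h]
  · by_cases hd : P.walk.SameCycle d₀ d <;> by_cases he : P.walk.SameCycle d₀ e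
    · exact hd.symm.trans he
    · simp [hd, he] at h
    · simp [hd, he] at h
    · have := hopp (((hiff d).2 hd).symm.trans ((hiff e).2 he))
      rwa [P.opp_opp, P.opp_opp] at this

/-! ### Lobes and interlacement -/

/-- The indicator function, with values in `ZMod 2`, of one of the two loops into which the
crossing `v` divides the curve, on the edges. As a function of darts, it is characterized (up to
exchange of the loops) by switching its value at the passages through `v` and at no others. -/
structure IsLobe (v : P.Crossing) (c : P.Dart → ZMod 2) : Prop where
  opp : ∀ d, c (P.opp d) = c d
  straight : ∀ u, u ≠ v → ∀ i, c (u, i + 2) = c (u, i)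
  switch : ∀ i, c (v, i + 2) = c (v, i) + 1

lemma IsLobe.add_one {v : P.Crossing} {c : P.Dart → ZMod 2} (hc : P.IsLobe v c) :
    P.IsLobe v (fun d => c d + 1) :=
  ⟨fun d => by rw [hc.opp], fun u hu i => by rw [hc.straight u hu], fun i => by rw [hc.switch]⟩

lemma IsLobe.eq_add {v : P.Crossing} {c c' : P.Dart → ZMod 2} (hP : P.IsSingleCurve)
    (hc : P.IsLobe v c) (hc' : P.IsLobe v c') (d e : P.Dart) : c d + c' d = c e + c' e := by
  refine hP.eq_of_straight (c := fun d => c d + c' d) (fun d => by rw [hc.opp, hc'.opp])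
    (fun u i => ?_) d e
  by_cases hu : u = v
  · subst hu
    have : ∀ x y : ZMod 2, x + 1 + (y + 1) = x + y := by decide
    rw [hc.switch, hc'.switch, this]
  · rw [hc.straight u hu, hc'.straight u hu]

/-- The curve leaves `v` by one dart of each of the two loops at `v`. -/
lemma IsLobe.add_orientation {v : P.Crossing} {c o : P.Dart → ZMod 2} (hc : P.IsLobe v c)
    (ho : P.IsOrientation o) : c (v, 1) + o (v, 1) = c (v, 0) + o (v, 0) + 1 := by
  by_contra hne
  -- otherwise both darts by which the curve leaves `v` have the same value, and a walk that
  -- starts by one of them can never come back to `v`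
  have key : ∀ i : Fin 4, c (v, i) + o (v, i) = c (v, 0) + o (v, 0) := by
    have h2 : c (v, 2) = c (v, 0) + 1 := hc.switch 0
    have h3 : c (v, 3) = c (v, 1) + 1 := hc.switch 1
    have h2' : o (v, 2) = o (v, 0) + 1 := ho.turn v 0
    have h3' : o (v, 3) = o (v, 1) + 1 := ho.turn v 1
    intro i
    fin_cases i
    · rfl
    · change c (v, 1) + o (v, 1) = _
      revert hne; generalize c (v, 1) + o (v, 1) = x; generalize c (v, 0) + o (v, 0) = y
      revert x y; decide
    · change c (v, 2) + o (v, 2) = _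
      rw [h2, h2']; generalize c (v, 0) = x; generalize o (v, 0) = y; revert x y; decide
    · change c (v, 3) + o (v, 3) = _
      rw [h3, h3']; revert hne
      generalize c (v, 0) = x; generalize o (v, 0) = y
      generalize c (v, 1) = z; generalize o (v, 1) = w; revert x y z w; decide
  have step : ∀ d : P.Dart, o d = o (v, 0) → c d = c (v, 0) →
      c (P.walk d) = c (v, 0) ∧ (P.walk d).1 ≠ v := by
    intro d hod hcd
    have h1 : c ((P.opp d).1, (P.opp d).2) = c (v, 0) := by rw [← hcd]; exact hc.opp d
    have h2 := ho.walk d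
    rw [walk_apply] at h2 ⊢
    by_cases h : (P.opp d).1 = v
    · exfalso
      have h3 := key ((P.opp d).2 + 2)
      rw [h] at h1 h2
      rw [hc.switch, h1, h2, hod] at h3
      revert h3
      generalize c (v, 0) = x; generalize o (v, 0) = y; revert x y; decide
    · exact ⟨by rw [hc.straight _ h, h1], h⟩
  have all : ∀ n : ℕ, o ((P.walk ^ n) (v, 0)) = o (v, 0) ∧ c ((P.walk ^ n) (v, 0)) = c (v, 0) := by
    intro n
    induction n with
    | zero => exact ⟨rfl, rfl⟩
    | succ n ih =>
      rw [pow_succ', Equiv.Perm.mul_apply]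
      exact ⟨by rw [ho.walk, ih.1], (step _ ih.1 ih.2).1⟩
  have hpos : 0 < orderOf P.walk := orderOf_pos _
  obtain ⟨n, hn⟩ : ∃ n, orderOf P.walk = n + 1 := ⟨_, (Nat.succ_pred_eq_of_pos hpos).symm⟩
  have h1 := pow_orderOf_eq_one P.walk
  rw [hn, pow_succ'] at h1
  have h2 := (step _ (all n).1 (all n).2).2
  rw [← Equiv.Perm.mul_apply, h1] at h2
  exact h2 rfl

/-- A splice is incoherent with the orientations of the curve exactly when it joins the two loops
at the crossing. -/
lemma IsLobe.incoherent_iff {v : P.Crossing} {c : P.Dart → ZMod 2} (hP : P.IsSingleCurve)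
    (hc : P.IsLobe v c) (b : Bool) :
    (∀ j, P.walk.SameCycle (v, j) (v, joined b j)) ↔ ∀ j, c (v, joined b j) = c (v, j) + 1 := by
  obtain ⟨o, ho⟩ := hP.exists_isOrientation
  have h1 : ∀ j, P.walk.SameCycle (v, j) (v, joined b j) ↔ o (v, j) = o (v, joined b j) :=
    fun j => ⟨ho.eq, ho.sameCycle _ _⟩
  have h := hc.add_orientation ho
  have c2 : c (v, 2) = c (v, 0) + 1 := hc.switch 0
  have c3 : c (v, 3) = c (v, 1) + 1 := hc.switch 1
  have o2 : o (v, 2) = o (v, 0) + 1 := ho.turn v 0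
  have o3 : o (v, 3) = o (v, 1) + 1 := ho.turn v 1
  simp only [h1]
  revert h c2 c3 o2 o3
  have key : ∀ (b : Bool) (x0 x1 x2 x3 y0 y1 y2 y3 : ZMod 2), x1 + y1 = x0 + y0 + 1 →
      x2 = x0 + 1 → x3 = x1 + 1 → y2 = y0 + 1 → y3 = y1 + 1 →
      ((∀ j, ![y0, y1, y2, y3] j = ![y0, y1, y2, y3] (joined b j)) ↔
        ∀ j, ![x0, x1, x2, x3] (joined b j) = ![x0, x1, x2, x3] j + 1) := by
    intro b x0 x1 x2 x3 y0 y1 y2 y3 h h2 h3 h4 h5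
    subst h2 h3 h4 h5
    obtain rfl : x1 = x0 + y0 + 1 + y1 := by
      rw [← h, add_assoc, CharTwo.add_self_eq_zero, add_zero]
    clear h
    revert b x0 y0 y1; decide
  have e : ∀ (f : P.Dart → ZMod 2) (j : Fin 4),
      f (v, j) = ![f (v, 0), f (v, 1), f (v, 2), f (v, 3)] j := by
    intro f j; fin_cases j <;> rfl
  intro h c2 c3 o2 o3
  have := key b _ _ _ _ _ _ _ _ h c2 c3 o2 o3
  simp only [← e] at this
  exact this

lemma IsLobe.exists_incoherent {v : P.Crossing} {c : P.Dart → ZMod 2} (hc : P.IsLobe v c) :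
    ∃ b, ∀ j, c (v, joined b j) = c (v, j) + 1 := by
  have c2 : c (v, 2) = c (v, 0) + 1 := hc.switch 0
  have c3 : c (v, 3) = c (v, 1) + 1 := hc.switch 1
  have key : ∀ (x0 x1 x2 x3 : ZMod 2), x2 = x0 + 1 → x3 = x1 + 1 →
      ∃ b, ∀ j, ![x0, x1, x2, x3] (joined b j) = ![x0, x1, x2, x3] j + 1 := by decide
  have e : ∀ (f : P.Dart → ZMod 2) (j : Fin 4),
      f (v, j) = ![f (v, 0), f (v, 1), f (v, 2), f (v, 3)] j := by
    intro f j; fin_cases j <;> rfl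
  have := key _ _ _ _ c2 c3
  simpa only [← e] using this

end FourValentMap

namespace FourValentMap

variable {P : FourValentMap}

/-! ### Planarity as exactness -/

/-- A cycle modulo `2`: a set of edges, as a function of darts with values in `ZMod 2`, that has
even degree at every crossing. -/
structure IsCycle (c : P.Dart → ZMod 2) : Prop where
  opp : ∀ d, c (P.opp d) = c d
  sum_eq_zero : ∀ v, ∑ i, c (v, i) = 0

/-- Every cycle modulo `2` is the boundary of a set of regions. The set of regions is given by a
function of darts that is invariant under the boundary walk. -/
def IsExact (P : FourValentMap) : Prop :=
  ∀ c : P.Dart → ZMod 2, P.IsCycle c → ∃ f : P.Dart → ZMod 2,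
    (∀ d, f (P.boundaryWalk d) = f d) ∧ ∀ d, c d = f d + f (P.opp d)

instance : Finite P.Region := by unfold Region; infer_instance

lemma regionAt_boundaryWalk (d : P.Dart) : P.regionAt (P.boundaryWalk d) = P.regionAt d :=
  Quotient.sound (Equiv.Perm.sameCycle_apply_left.2 (Equiv.Perm.SameCycle.refl _ _))

lemma apply_opp_of_invariant {α : Type*} {f : P.Dart → α} (hf : ∀ d, f (P.boundaryWalk d) = f d)
    (v : P.Crossing) (i : Fin 4) : f (P.opp (v, i)) = f (v, i + -1) := by
  rw [← hf, boundaryWalk_opp]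

/-- The map `c ↦ c + c ∘ opp`, whose kernel consists of the functions of edges. -/
def oppSum (P : FourValentMap) : (P.Dart → ZMod 2) →ₗ[ZMod 2] (P.Dart → ZMod 2) :=
  LinearMap.id + LinearMap.funLeft (ZMod 2) (ZMod 2) P.opp

lemma oppSum_apply (c : P.Dart → ZMod 2) (d : P.Dart) : P.oppSum c d = c d + c (P.opp d) := rfl

/-- The space of functions of edges. -/
abbrev EdgeSpace (P : FourValentMap) : Submodule (ZMod 2) (P.Dart → ZMod 2) :=
  LinearMap.ker P.oppSum

lemma mem_edgeSpace {c : P.Dart → ZMod 2} : c ∈ P.EdgeSpace ↔ ∀ d, c (P.opp d) = c d := by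
  rw [LinearMap.mem_ker, funext_iff]
  refine forall_congr' fun d => ?_
  have key : ∀ x y : ZMod 2, x + y = 0 ↔ y = x := by decide
  exact key _ _

/-- The boundary map from edges to crossings. -/
def edgeBoundary (P : FourValentMap) : P.EdgeSpace →ₗ[ZMod 2] (P.Crossing → ZMod 2) :=
  (LinearMap.pi fun v => ∑ i : Fin 4, LinearMap.proj (v, i)).domRestrict P.EdgeSpace

lemma edgeBoundary_apply (c : P.EdgeSpace) (v : P.Crossing) :
    P.edgeBoundary c v = ∑ i, c.1 (v, i) := by
  simp [edgeBoundary]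

/-- The boundary map from regions to edges. -/
def regionBoundary (P : FourValentMap) : (P.Region → ZMod 2) →ₗ[ZMod 2] P.EdgeSpace :=
  (P.oppSum ∘ₗ LinearMap.funLeft (ZMod 2) (ZMod 2) P.regionAt).codRestrict P.EdgeSpace
    fun g => mem_edgeSpace.2 fun d => by
      simp [oppSum_apply, P.opp_opp, add_comm]

lemma regionBoundary_apply (g : P.Region → ZMod 2) (d : P.Dart) :
    (P.regionBoundary g).1 d = g (P.regionAt d) + g (P.regionAt (P.opp d)) := rfl

lemma finrank_edgeSpace (hP : P.IsSingleCurve) :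
    Module.finrank (ZMod 2) P.EdgeSpace = 2 * Nat.card P.Crossing := by
  classical
  have := Fintype.ofFinite P.Crossing
  obtain ⟨o, ho⟩ := hP.exists_isOrientation
  have h1 : LinearMap.range P.oppSum = P.EdgeSpace := by
    ext c
    rw [mem_edgeSpace]
    constructor
    · rintro ⟨c, rfl⟩ d
      rw [oppSum_apply, oppSum_apply, P.opp_opp, add_comm]
    · intro hc
      refine ⟨fun d => o d * c d, funext fun d => ?_⟩
      rw [oppSum_apply, hc, ho.opp]
      generalize c d = x; generalize o d = y; revert x y; decide
  have h2 := P.oppSum.finrank_range_add_finrank_ker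
  rw [h1, Module.finrank_fintype_fun_eq_card, Fintype.card_prod, Fintype.card_fin] at h2
  rw [Nat.card_eq_fintype_card]
  change Module.finrank (ZMod 2) P.EdgeSpace + Module.finrank (ZMod 2) P.EdgeSpace = _ at h2
  omega

lemma sum_dart_eq_zero [Fintype P.Crossing] {c : P.Dart → ZMod 2}
    (hc : ∀ d, c (P.opp d) = c d) : ∑ d, c d = 0 := by
  refine Finset.sum_involution (fun d _ => P.opp d) (fun d _ => ?_) (fun d _ _ => P.opp_ne d)
    (fun d _ => Finset.mem_univ _) (fun d _ => P.opp_opp d)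
  rw [hc, CharTwo.add_self_eq_zero]

lemma finrank_ker_edgeBoundary (hP : P.IsSingleCurve) :
    Module.finrank (ZMod 2) (LinearMap.ker P.edgeBoundary) = Nat.card P.Crossing + 1 := by
  classical
  have := Fintype.ofFinite P.Crossing
  obtain ⟨⟨v₀, -⟩, -⟩ := id hP
  let total : (P.Crossing → ZMod 2) →ₗ[ZMod 2] ZMod 2 := ∑ v, LinearMap.proj v
  have total_apply : ∀ φ, total φ = ∑ v, φ v := fun φ => by simp [total]
  -- the image of the boundary map consists of the sets of crossings of even size
  have hdiff : ∀ v, Pi.single v (1 : ZMod 2) + Pi.single v₀ 1 ∈ LinearMap.range P.edgeBoundary := by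
    have hzero : ∀ x : P.Crossing → ZMod 2, x + x = 0 := fun x =>
      funext fun v => CharTwo.add_self_eq_zero (x v)
    have hedge : ∀ d : P.Dart, Pi.single d.1 (1 : ZMod 2) + Pi.single (P.opp d).1 1 ∈
        LinearMap.range P.edgeBoundary := by
      intro d
      refine ⟨⟨Pi.single d 1 + Pi.single (P.opp d) 1, mem_edgeSpace.2 fun e => ?_⟩,
        funext fun v => ?_⟩
      · have h1 : P.opp e = d ↔ e = P.opp d :=
          ⟨fun h => by rw [← h, P.opp_opp], fun h => by rw [h, P.opp_opp]⟩
        have h2 : P.opp e = P.opp d ↔ e = d := opp_injective.eq_iff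
        simp [Pi.single_apply, h1, h2, add_comm]
      · have h3 : ∀ e : P.Dart, ∑ i, Pi.single (M := fun _ : P.Dart => ZMod 2) e 1 (v, i) =
            Pi.single (M := fun _ : P.Crossing => ZMod 2) e.1 1 v := by
          rintro ⟨w, j⟩
          by_cases h : v = w
          · subst h; simp [Pi.single_apply]
          · simp [h]
        simp only [edgeBoundary_apply, Pi.add_apply, Finset.sum_add_distrib, h3]
    intro v
    have := hP.eq_of_straight (c := fun d : P.Dart => Pi.single d.1 (1 : ZMod 2) +
      Pi.single v₀ 1 ∈ LinearMap.range P.edgeBoundary) (fun d => by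
        have h := hedge d
        refine propext ⟨fun h' => ?_, fun h' => ?_⟩
        · have := add_mem h h'
          rwa [add_assoc, ← add_assoc (Pi.single (P.opp d).1 1), hzero, zero_add] at this
        · have := add_mem h h'
          rwa [add_comm (Pi.single d.1 1), add_assoc, ← add_assoc (Pi.single d.1 1), hzero,
            zero_add] at this) (fun _ _ => rfl) (v, 0) (v₀, 0)
    exact this ▸ (by rw [hzero]; exact zero_mem _)
  have hrange : LinearMap.range P.edgeBoundary = LinearMap.ker total := by
    apply le_antisymm
    · rintro _ ⟨c, rfl⟩
      rw [LinearMap.mem_ker, total_apply]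
      simp only [edgeBoundary_apply]
      rw [← Fintype.sum_prod_type' (f := fun v i => c.1 (v, i))]
      exact sum_dart_eq_zero (mem_edgeSpace.1 c.2)
    · intro φ hφ
      rw [LinearMap.mem_ker, total_apply] at hφ
      have h : φ = ∑ v, φ v • (Pi.single v (1 : ZMod 2) + Pi.single v₀ 1) := by
        simp only [smul_add, Finset.sum_add_distrib, ← Finset.sum_smul, hφ, zero_smul, add_zero]
        ext v
        simp [Finset.sum_apply, Pi.single_apply]
      rw [h]
      exact sum_mem fun v _ => Submodule.smul_mem _ _ (hdiff v)
  have htop : LinearMap.range total = ⊤ := by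
    rw [LinearMap.range_eq_top]
    intro x
    exact ⟨Pi.single v₀ x, by rw [total_apply]; simp⟩
  have h1 := P.edgeBoundary.finrank_range_add_finrank_ker
  have h2 := total.finrank_range_add_finrank_ker
  rw [htop, finrank_top, Module.finrank_self, Module.finrank_fintype_fun_eq_card,
    ← Nat.card_eq_fintype_card] at h2
  rw [hrange, finrank_edgeSpace hP] at h1
  omega

lemma finrank_range_regionBoundary (hP : P.IsSingleCurve) :
    Module.finrank (ZMod 2) (LinearMap.range P.regionBoundary) + 1 = Nat.card P.Region := by
  classical
  have := Fintype.ofFinite P.Region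
  obtain ⟨d₀, -⟩ := id hP
  -- the kernel consists of the constant functions
  have hker : LinearMap.ker P.regionBoundary = Submodule.span (ZMod 2) {fun _ => 1} := by
    apply le_antisymm
    · intro g hg
      have h : ∀ d, g (P.regionAt (P.opp d)) = g (P.regionAt d) := fun d => by
        have := congrFun (congrArg Subtype.val (LinearMap.mem_ker.1 hg)) d
        rw [regionBoundary_apply] at this
        revert this
        generalize g (P.regionAt d) = x; generalize g (P.regionAt (P.opp d)) = y
        change x + y = 0 → _
        revert x y; decide
      have h' : ∀ v i, g (P.regionAt (v, i + -1)) = g (P.regionAt (v, i)) := fun v i => by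
        rw [← apply_opp_of_invariant (f := fun d => g (P.regionAt d))
          (fun d => by rw [regionAt_boundaryWalk]), h]
      have hc := hP.eq_of_straight (c := fun d => g (P.regionAt d)) h (fun v i => by
        have e : ∀ i : Fin 4, i + 2 + -1 + -1 = i := by decide
        rw [← h' v (i + 2), ← h', e])
      refine Submodule.mem_span_singleton.2 ⟨g (P.regionAt d₀), funext fun r => ?_⟩
      induction r using Quotient.inductionOn with
      | h d =>
        change g (P.regionAt d₀) * 1 = g (P.regionAt d)
        rw [mul_one]
        exact hc d₀ d
    · rw [Submodule.span_singleton_le_iff_mem, LinearMap.mem_ker]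
      ext d
      rw [regionBoundary_apply]
      rfl
  have h1 := P.regionBoundary.finrank_range_add_finrank_ker
  have hne : (fun _ : P.Region => (1 : ZMod 2)) ≠ 0 := fun h =>
    one_ne_zero (congrFun h (P.regionAt d₀))
  rw [hker, finrank_span_singleton hne, Module.finrank_fintype_fun_eq_card,
    ← Nat.card_eq_fintype_card] at h1
  exact h1

/-- A single curve lies on the sphere if and only if the first homology modulo `2` vanishes: both
the dimension of the space of cycles and the dimension of the space of boundaries are known. -/
lemma isPlanar_iff_isExact (hP : P.IsSingleCurve) : P.IsPlanar ↔ P.IsExact := by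
  have h1 := finrank_ker_edgeBoundary hP
  have h2 := finrank_range_regionBoundary hP
  have hle : LinearMap.range P.regionBoundary ≤ LinearMap.ker P.edgeBoundary := by
    rintro _ ⟨g, rfl⟩
    rw [LinearMap.mem_ker]
    ext v
    rw [edgeBoundary_apply]
    have h := apply_opp_of_invariant (f := fun d => g (P.regionAt d))
          (fun d => by rw [regionAt_boundaryWalk]) v
    simp only [regionBoundary_apply, h, Fin.sum_univ_four]
    change g (P.regionAt (v, 0)) + g (P.regionAt (v, 3)) +
      (g (P.regionAt (v, 1)) + g (P.regionAt (v, 0))) +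
      (g (P.regionAt (v, 2)) + g (P.regionAt (v, 1))) +
      (g (P.regionAt (v, 3)) + g (P.regionAt (v, 2))) = 0
    generalize g (P.regionAt (v, 0)) = x; generalize g (P.regionAt (v, 1)) = y
    generalize g (P.regionAt (v, 2)) = z; generalize g (P.regionAt (v, 3)) = t
    revert x y z t; decide
  have hex : P.IsExact ↔ LinearMap.ker P.edgeBoundary ≤ LinearMap.range P.regionBoundary := by
    constructor
    · intro h c hc
      have hc' : P.IsCycle c.1 := ⟨mem_edgeSpace.1 c.2, fun v => by
        rw [← edgeBoundary_apply, LinearMap.mem_ker.1 hc]; rfl⟩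
      obtain ⟨f, hf, hcf⟩ := h _ hc'
      refine ⟨Quotient.lift f fun a b hab => eq_of_sameCycle hf hab, ?_⟩
      ext d
      exact (hcf d).symm
    · intro h c hc
      obtain ⟨g, hg⟩ := @h ⟨c, mem_edgeSpace.2 hc.opp⟩ (by
        rw [LinearMap.mem_ker]; ext v; rw [edgeBoundary_apply]; exact hc.sum_eq_zero v)
      refine ⟨fun d => g (P.regionAt d), fun d => congrArg g (regionAt_boundaryWalk d),
        fun d => ?_⟩
      rw [← regionBoundary_apply, hg]
  rw [hex, IsPlanar]
  constructor
  · intro h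
    exact (Submodule.eq_of_le_of_finrank_eq hle (by omega)).ge
  · intro h
    rw [le_antisymm hle h] at h2
    omega

end FourValentMap

/-! ### Reducible crossings -/

namespace FourValentMap

variable {P : FourValentMap}

lemma forall_fin_four {p : Fin 4 → Prop} (i : Fin 4) :
    (∀ j, p j) ↔ p i ∧ p (i + 1) ∧ p (i + 2) ∧ p (i + 3) := by
  refine ⟨fun h => ⟨h _, h _, h _, h _⟩, fun h j => ?_⟩
  have : ∀ i j : Fin 4, j = i ∨ j = i + 1 ∨ j = i + 2 ∨ j = i + 3 := by decide
  rcases this i j with rfl | rfl | rfl | rfl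
  · exact h.1
  · exact h.2.1
  · exact h.2.2.1
  · exact h.2.2.2

lemma sum_fin_four {α : Type*} [AddCommMonoid α] (f : Fin 4 → α) (i : Fin 4) :
    ∑ j, f j = f i + f (i + 1) + f (i + 2) + f (i + 3) := by
  rw [← Equiv.sum_comp (Equiv.addLeft i), Fin.sum_univ_four]
  simp

/-- A lobe takes the value `1` on two neighbouring darts at its crossing. -/
lemma IsLobe.exists_corner {v : P.Crossing} {c : P.Dart → ZMod 2} (hc : P.IsLobe v c) :
    ∃ i, c (v, i) = 1 ∧ c (v, i + 1) = 1 ∧ c (v, i + 2) = 0 ∧ c (v, i + 3) = 0 := by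
  have c2 : c (v, 2) = c (v, 0) + 1 := hc.switch 0
  have c3 : c (v, 3) = c (v, 1) + 1 := hc.switch 1
  have key : ∀ (x0 x1 x2 x3 : ZMod 2), x2 = x0 + 1 → x3 = x1 + 1 →
      ∃ i : Fin 4, ![x0, x1, x2, x3] i = 1 ∧ ![x0, x1, x2, x3] (i + 1) = 1 ∧
        ![x0, x1, x2, x3] (i + 2) = 0 ∧ ![x0, x1, x2, x3] (i + 3) = 0 := by decide
  have e : ∀ j : Fin 4, c (v, j) = ![c (v, 0), c (v, 1), c (v, 2), c (v, 3)] j := by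
    intro j; fin_cases j <;> rfl
  have := key _ _ _ _ c2 c3
  simpa only [← e] using this

lemma IsLobe.isCycle {v : P.Crossing} {c : P.Dart → ZMod 2} (hc : P.IsLobe v c) :
    P.IsCycle c := by
  refine ⟨hc.opp, fun u => ?_⟩
  rw [Fin.sum_univ_four]
  by_cases hu : u = v
  · subst hu
    have c2 : c (u, 2) = c (u, 0) + 1 := hc.switch 0
    have c3 : c (u, 3) = c (u, 1) + 1 := hc.switch 1
    rw [c2, c3]; generalize c (u, 0) = x; generalize c (u, 1) = y; revert x y; decide
  · have c2 : c (u, 2) = c (u, 0) := hc.straight u hu 0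
    have c3 : c (u, 3) = c (u, 1) := hc.straight u hu 1
    rw [c2, c3]; generalize c (u, 0) = x; generalize c (u, 1) = y; revert x y; decide

/-- The region in the corner of a loop at its crossing differs from the regions at the other
corners: the loop is the boundary of a set of regions that separates them. -/
lemma regionAt_ne_of_corner (hex : P.IsExact) {v : P.Crossing} {c : P.Dart → ZMod 2}
    (hc : P.IsLobe v c) {i : Fin 4} (h2 : c (v, i + 2) = 0) (h3 : c (v, i + 3) = 0)
    (h0 : c (v, i) = 1) :
    P.regionAt (v, i) ≠ P.regionAt (v, i + 1) ∧ P.regionAt (v, i) ≠ P.regionAt (v, i + 2) ∧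
      P.regionAt (v, i) ≠ P.regionAt (v, i + 3) := by
  obtain ⟨f, hf, hcf⟩ := hex c hc.isCycle
  have hreg : ∀ {d e}, P.regionAt d = P.regionAt e → f d = f e := fun h =>
    eq_of_sameCycle hf (Quotient.exact h)
  have e0 := hcf (v, i)
  have e2 := hcf (v, i + 2)
  have e3 := hcf (v, i + 3)
  rw [apply_opp_of_invariant hf] at e0 e2 e3
  have a0 : ∀ i : Fin 4, i + -1 = i + 3 := by decide
  have a2 : ∀ i : Fin 4, i + 2 + -1 = i + 1 := by decide
  have a3 : ∀ i : Fin 4, i + 3 + -1 = i + 2 := by decide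
  rw [h0, a0] at e0
  rw [h2, a2] at e2
  rw [h3, a3] at e3
  have key : ∀ x0 x1 x2 x3 : ZMod 2, 1 = x0 + x3 → 0 = x2 + x1 → 0 = x3 + x2 →
    x0 ≠ x1 ∧ x0 ≠ x2 ∧ x0 ≠ x3 := by decide
  obtain ⟨k1, k2, k3⟩ := key _ _ _ _ e0 e2 e3
  exact ⟨fun h => k1 (hreg h), fun h => k2 (hreg h), fun h => k3 (hreg h)⟩

/-- If neither of the loops at `v` meets the other one elsewhere, then the two corners at `v`
between the loops belong to the same region: the part of the boundary of that region on one of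
the loops has even degree at every crossing. -/
lemma regionAt_eq_of_isolated {v : P.Crossing} {c : P.Dart → ZMod 2} (hc : P.IsLobe v c)
    (hiso : ∀ u, u ≠ v → c (u, 2) = c (u, 3)) {i : Fin 4} (h0 : c (v, i) = 1)
    (h1 : c (v, i + 1) = 1) (h2 : c (v, i + 2) = 0) (h3 : c (v, i + 3) = 0) :
    P.regionAt (v, i + 1) = P.regionAt (v, i + 3) := by
  classical
  have := Fintype.ofFinite P.Crossing
  let χ : P.Dart → ZMod 2 := fun d => if P.regionAt d = P.regionAt (v, i + 1) then 1 else 0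
  have hχ : ∀ d, χ (P.boundaryWalk d) = χ d := fun d => by
    simp only [χ, regionAt_boundaryWalk]
  have hsum : ∑ d, c d * (χ d + χ (P.opp d)) = 0 :=
    sum_dart_eq_zero (c := fun d => c d * (χ d + χ (P.opp d))) fun d => by
      simp only [hc.opp, P.opp_opp, add_comm]
  rw [Fintype.sum_prod_type, Finset.sum_eq_single v (fun u _ hu => ?_) (by simp)] at hsum
  · rw [sum_fin_four _ i] at hsum
    simp only [apply_opp_of_invariant hχ, h0, h1, h2, h3, one_mul, zero_mul, add_zero] at hsum
    have a0 : ∀ i : Fin 4, i + -1 = i + 3 := by decide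
    have a1 : ∀ i : Fin 4, i + 1 + -1 = i := by decide
    rw [a0, a1] at hsum
    by_contra hne
    have e1 : χ (v, i + 1) = 1 := if_pos rfl
    have e3 : χ (v, i + 3) = 0 := if_neg fun h => hne h.symm
    rw [e1, e3] at hsum
    revert hsum; generalize χ (v, i) = x; revert x; decide
  · have k0 : c (u, 0) = c (u, 2) := (hc.straight u hu 0).symm
    have k1 : c (u, 1) = c (u, 2) := (hc.straight u hu 1).symm.trans (hiso u hu).symm
    have k3 : c (u, 3) = c (u, 2) := (hiso u hu).symm
    simp only [apply_opp_of_invariant hχ, Fin.sum_univ_four, k0, k1, k3]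
    change c (u, 2) * (χ (u, 0) + χ (u, 3)) + c (u, 2) * (χ (u, 1) + χ (u, 0)) +
      c (u, 2) * (χ (u, 2) + χ (u, 1)) + c (u, 2) * (χ (u, 3) + χ (u, 2)) = 0
    generalize χ (u, 0) = x; generalize χ (u, 1) = y
    generalize χ (u, 2) = z; generalize χ (u, 3) = t
    have key : ∀ a x y z t : ZMod 2,
      a * (x + t) + a * (y + x) + a * (z + y) + a * (t + z) = 0 := by decide
    exact key _ _ _ _ _

/-- If the two corners at `v` between the loops belong to the same region, then the loops do not
meet elsewhere. The boundary walk from one corner to the other is a cycle, hence the boundary of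
a set of regions. The curve that connects the two corners inside their region separates this
walk from the set of regions, up to which it is a lobe; this lobe is constant around every other
crossing, as the connecting curve does not come near it. -/
lemma isolated_of_regionAt_eq (hP : P.IsSingleCurve) (hex : P.IsExact) {v : P.Crossing}
    {c : P.Dart → ZMod 2} (hc : P.IsLobe v c) {i : Fin 4}
    (h : P.regionAt (v, i) = P.regionAt (v, i + 2)) (u : P.Crossing) (hu : u ≠ v) :
    c (u, 2) = c (u, 3) := by
  classical
  have hcyc : P.boundaryWalk.SameCycle (v, i) (v, i + 2) := Quotient.exact h
  obtain ⟨n, -, hn⟩ := hcyc.exists_pow_eq'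
  let s : P.Dart → P.Dart → ZMod 2 := fun e d => if e = d then 1 else 0
  -- the number of times that the boundary walk from `(v, i)` to `(v, i + 2)` takes a dart
  let D : P.Dart → ZMod 2 := fun d => ∑ k ∈ Finset.range n, s ((P.boundaryWalk ^ k) (v, i)) d
  have hD : ∀ d, D (P.boundaryWalk d) + s (v, i + 2) (P.boundaryWalk d) =
      D d + s (v, i) (P.boundaryWalk d) := by
    intro d
    have e1 := Finset.sum_range_succ
      (fun k => s ((P.boundaryWalk ^ k) (v, i)) (P.boundaryWalk d)) n
    have e2 := Finset.sum_range_succ'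
      (fun k => s ((P.boundaryWalk ^ k) (v, i)) (P.boundaryWalk d)) n
    rw [e1, hn] at e2
    refine e2.trans (congrArg₂ _ (Finset.sum_congr rfl fun k _ => ?_) rfl)
    simp only [s, pow_succ', Equiv.Perm.mul_apply, EmbeddingLike.apply_eq_iff_eq]
  have hD' : ∀ w j, D (P.opp (w, j)) =
      D (w, j + -1) + s (v, i + 2) (w, j + -1) + s (v, i) (w, j + -1) := by
    intro w j
    have := hD (P.opp (w, j))
    rw [boundaryWalk_opp] at this
    rw [this, add_assoc, CharTwo.add_self_eq_zero, add_zero]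
  have s_ne : ∀ w, w ≠ v → ∀ j k, s (v, j) (w, k) = 0 := fun w hw j k =>
    if_neg fun h => hw (congrArg Prod.fst h).symm
  have s_eq : ∀ j k, s (v, j) (v, k) = if j = k then 1 else 0 := fun j k => by
    simp [s]
  have hcycle : P.IsCycle fun d => D d + D (P.opp d) := by
    refine ⟨fun d => by rw [P.opp_opp, add_comm], fun w => ?_⟩
    have e : ∑ j, s (v, i + 2) (w, j + -1) + ∑ j, s (v, i) (w, j + -1) = 0 := by
      by_cases hw : w = v
      · subst hw
        simp only [s_eq]
        clear * -
        revert i; decide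
      · simp [s_ne w hw]
    have e' : ∑ j, D (w, j + -1) = ∑ j, D (w, j) :=
      Equiv.sum_comp (Equiv.addRight (-1 : Fin 4)) fun j => D (w, j)
    simp only [hD', Finset.sum_add_distrib, e', add_assoc, e, add_zero]
    exact CharTwo.add_self_eq_zero _
  obtain ⟨g, hg, hgD⟩ := hex _ hcycle
  let h : P.Dart → ZMod 2 := fun d => g d + D d
  have h_opp : ∀ d, h (P.opp d) = h d := fun d => by
    have := hgD d
    simp only [h]
    revert this
    generalize D d = x; generalize D (P.opp d) = y; generalize g d = z
    generalize g (P.opp d) = t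
    have key : ∀ x y z t : ZMod 2, x + y = z + t → t + y = z + x := by decide
    exact key x y z t
  have h_turn : ∀ w j, h (w, j) = h (w, j + -1) + s (v, i + 2) (w, j + -1) +
      s (v, i) (w, j + -1) := fun w j => by
    rw [← h_opp]
    simp only [h, apply_opp_of_invariant hg, hD', add_assoc]
  have h_const : ∀ w, w ≠ v → ∀ j, h (w, j) = h (w, j + -1) := fun w hw j => by
    rw [h_turn, s_ne w hw, s_ne w hw, add_zero, add_zero]
  have hlobe : P.IsLobe v h := by
    have a : ∀ j : Fin 4, j + 2 + -1 + -1 = j := by decide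
    refine ⟨h_opp, fun w hw j => ?_, fun j => ?_⟩
    · rw [h_const w hw (j + 2), h_const w hw, a]
    · rw [h_turn v (j + 2), h_turn v (j + 2 + -1), a, s_eq, s_eq, s_eq, s_eq]
      generalize h (v, j) = x
      clear * -
      revert i j x; decide
  have hsum := hc.eq_add hP hlobe (u, 2) (u, 3)
  rw [h_const u hu 3] at hsum
  exact add_right_cancel hsum

/-- A crossing is reducible if and only if it is interlaced with no other crossing. -/
lemma ncard_regionAt_eq_three_iff (hP : P.IsSingleCurve) (hex : P.IsExact) {v : P.Crossing}
    {c : P.Dart → ZMod 2} (hc : P.IsLobe v c) :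
    (Set.range fun i : Fin 4 => P.regionAt (v, i)).ncard = 3 ↔
      ∀ u, u ≠ v → c (u, 2) = c (u, 3) := by
  obtain ⟨i, h0, h1, h2, h3⟩ := hc.exists_corner
  obtain ⟨n01, n02, n03⟩ := regionAt_ne_of_corner hex hc h2 h3 h0
  obtain ⟨n23, n20, n21⟩ := regionAt_ne_of_corner (i := i + 2) hex hc.add_one
    (by have : ∀ i : Fin 4, i + 2 + 2 = i := by decide
        rw [this, h0]; rfl)
    (by have : ∀ i : Fin 4, i + 2 + 3 = i + 1 := by decide
        rw [this, h1]; rfl) (by rw [h2, zero_add])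
  have a1 : ∀ i : Fin 4, i + 2 + 1 = i + 3 := by decide
  have a3 : ∀ i : Fin 4, i + 2 + 3 = i + 1 := by decide
  rw [a1] at n23
  rw [a3] at n21
  have hrange : (Set.range fun i : Fin 4 => P.regionAt (v, i)) =
      {P.regionAt (v, i), P.regionAt (v, i + 2), P.regionAt (v, i + 1), P.regionAt (v, i + 3)} := by
    ext r
    constructor
    · rintro ⟨j, rfl⟩
      revert j
      rw [forall_fin_four i]
      simp
    · rintro (rfl | rfl | rfl | rfl) <;> exact ⟨_, rfl⟩
  constructor
  · intro hcard
    by_cases h : P.regionAt (v, i + 1) = P.regionAt (v, i + 3)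
    · rw [← a1, add_right_comm] at h
      exact isolated_of_regionAt_eq hP hex hc h
    · exfalso
      rw [hrange, Set.ncard_insert_of_notMem (by simp [n01, n02, n03]),
        Set.ncard_insert_of_notMem (by simp [n21, n23]), Set.ncard_pair h] at hcard
      omega
  · intro hiso
    have h := regionAt_eq_of_isolated hc hiso h0 h1 h2 h3
    rw [hrange, h, Set.pair_eq_singleton, Set.ncard_insert_of_notMem (by simp [n02, n03]),
      Set.ncard_pair n23]

end FourValentMap

namespace FourValentMap

variable {P : FourValentMap}

/-! ### Splices -/

lemma isLobe_apply_joined_of_ne {v w : P.Crossing} (hwv : v ≠ w) {c : P.Dart → ZMod 2}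
    (hc : P.IsLobe w c) (b : Bool) (j : Fin 4) :
    c (v, joined b j) = c (v, j) + (c (v, 2) + c (v, 3)) := by
  have c2 : c (v, 2) = c (v, 0) := hc.straight v hwv 0
  have c3 : c (v, 3) = c (v, 1) := hc.straight v hwv 1
  have e : ∀ j : Fin 4, c (v, j) = ![c (v, 2), c (v, 3), c (v, 2), c (v, 3)] j := by
    intro j; fin_cases j
    · exact c2.symm
    · exact c3.symm
    · rfl
    · rfl
  rw [e, e j]
  generalize c (v, 2) = x; generalize c (v, 3) = y
  revert b j x y; decide

/-- If `v` is interlaced with some crossing, then no edge connects `v` to itself. -/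
lemma IsLobe.opp_fst_ne (hP : P.IsSingleCurve) {v : P.Crossing} {c : P.Dart → ZMod 2}
    (hc : P.IsLobe v c) {u : P.Crossing} (hu : u ≠ v) (h : c (u, 2) ≠ c (u, 3)) (j : Fin 4) :
    (P.opp (v, j)).1 ≠ v := by
  classical
  intro hv
  obtain ⟨k, hk⟩ : ∃ k, P.opp (v, j) = (v, k) := ⟨_, Prod.ext hv rfl⟩
  have hk' : P.opp (v, k) = (v, j) := by rw [← hk, P.opp_opp]
  have hkj : k ≠ j := by
    rintro rfl
    exact P.opp_ne _ hk
  have hkj2 : k ≠ j + 2 := by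
    rintro rfl
    have := hc.opp (v, j)
    rw [hk, hc.switch] at this
    revert this; generalize c (v, j) = x; revert x; decide
  -- the edge itself is a lobe, and interlaced with nothing
  let l : P.Dart → ZMod 2 := fun d => if d = (v, j) ∨ d = (v, k) then 1 else 0
  have hl : P.IsLobe v l := by
    refine ⟨fun d => ?_, fun w hw i => ?_, fun i => ?_⟩
    · have h1 : P.opp d = (v, j) ↔ d = (v, k) := by rw [← hk', opp_injective.eq_iff]
      have h2 : P.opp d = (v, k) ↔ d = (v, j) := by rw [← hk, opp_injective.eq_iff]
      simp only [l, h1, h2, or_comm]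
    · simp [l, hw]
    · simp only [l, Prod.mk.injEq, true_and]
      clear * - hkj hkj2
      revert i j k; decide
  have := hc.eq_add hP hl (u, 2) (u, 3)
  simp only [l, Prod.mk.injEq, hu, false_and, or_self, if_false, add_zero] at this
  exact h this

/-- A function of edges that takes the same values on joined darts is a function of edges after
the splice. -/
lemma apply_spliceOpp {α : Type*} {v : P.Crossing} {b : Bool} {c : P.Dart → α}
    (hopp : ∀ d, c (P.opp d) = c d) (hj : ∀ j, c (v, joined b j) = c (v, j)) (d : P.Dart) :
    c (P.spliceOpp v b d) = c d := by
  have h : ∀ d, c (P.pass v b d) = c d := by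
    rintro ⟨w, j⟩
    by_cases hw : w = v
    · subst hw; rw [pass_of_eq, hopp, hj]
    · rw [pass_of_ne _ _ hw]
  rw [spliceOpp, h, h, hopp]

/-- The dart of `P` that a dart of the splice comes from. -/
def spliceDart {v : P.Crossing} {b : Bool} (d : (P.splice v b).Dart) : P.Dart := (d.1.1, d.2)

lemma spliceDart_opp {v : P.Crossing} {b : Bool} (d : (P.splice v b).Dart) :
    spliceDart ((P.splice v b).opp d) = P.spliceOpp v b (spliceDart d) := rfl

/-- Interlacement after the splice: the loops at `w` are corrected by those at `v` when `v` and
`w` are interlaced. -/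
lemma IsLobe.splice {v w : P.Crossing} (hwv : v ≠ w) {b : Bool} {c cv : P.Dart → ZMod 2}
    (hc : P.IsLobe w c) (hcv : P.IsLobe v cv) (hb : ∀ j, cv (v, joined b j) = cv (v, j) + 1) :
    (P.splice v b).IsLobe ⟨w, hwv.symm⟩ fun d =>
      c (spliceDart d) + (c (v, 2) + c (v, 3)) * cv (spliceDart d) := by
  refine ⟨fun d => ?_, fun u hu i => ?_, fun i => ?_⟩
  · rw [spliceDart_opp]
    refine apply_spliceOpp (c := fun d => c d + (c (v, 2) + c (v, 3)) * cv d)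
      (fun d => by rw [hc.opp, hcv.opp]) (fun j => ?_) _
    rw [isLobe_apply_joined_of_ne hwv hc, hb]
    generalize c (v, 2) + c (v, 3) = x; generalize c (v, j) = y; generalize cv (v, j) = z
    revert x y z; decide
  · have h1 : u.1 ≠ w := fun h => hu (Subtype.ext h)
    simp only [spliceDart]
    rw [hc.straight _ h1, hcv.straight _ u.2]
  · simp only [spliceDart]
    rw [hc.switch, hcv.straight _ hwv.symm, add_right_comm]

section Extension

variable {v : P.Crossing} {b : Bool} {α : Type*}

/-- Extension of a function of edges of the splice to the edges before the splice, where no edge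
connects the crossing `v` to itself. -/
noncomputable def spliceExtend (hv : ∀ j, (P.opp (v, j)).1 ≠ v) (c : (P.splice v b).Dart → α)
    (d : P.Dart) : α :=
  open Classical in if h : d.1 = v then
    c (⟨(P.opp d).1, by obtain ⟨w, j⟩ := d; obtain rfl : w = v := h; exact hv j⟩, (P.opp d).2)
  else c (⟨d.1, h⟩, d.2)

variable (hv : ∀ j, (P.opp (v, j)).1 ≠ v) {c : (P.splice v b).Dart → α}

lemma spliceExtend_spliceDart (d : (P.splice v b).Dart) :
    spliceExtend hv c (spliceDart d) = c d := by
  rw [spliceExtend, dif_neg (show ¬ (spliceDart d).1 = v from d.1.2)]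
  rfl

lemma spliceExtend_of_ne (d : P.Dart) (h : d.1 ≠ v) :
    spliceExtend hv c d = c (⟨d.1, h⟩, d.2) := dif_neg h

lemma spliceExtend_opp (hc : ∀ d, c ((P.splice v b).opp d) = c d) (d : P.Dart) :
    spliceExtend hv c (P.opp d) = spliceExtend hv c d := by
  have key : ∀ j, spliceExtend hv c (P.opp (v, j)) = spliceExtend hv c (v, j) := fun j => by
    rw [spliceExtend_of_ne hv _ (hv j), spliceExtend, dif_pos rfl]
  by_cases h : d.1 = v
  · obtain ⟨w, j⟩ := d
    obtain rfl : w = v := h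
    exact key j
  · by_cases h' : (P.opp d).1 = v
    · obtain ⟨j, hj⟩ : ∃ j, P.opp d = (v, j) := ⟨(P.opp d).2, Prod.ext h' rfl⟩
      rw [← P.opp_opp d, hj, P.opp_opp, key]
    · rw [spliceExtend_of_ne hv _ h, spliceExtend_of_ne hv _ h', ← hc (⟨d.1, h⟩, d.2)]
      congr 1
      have e : P.spliceOpp v b d = P.opp d := by
        rw [spliceOpp, pass_of_ne _ _ h', pass_of_ne _ _ h']
      refine Prod.ext (Subtype.ext ?_) ?_
      · exact (congrArg Prod.fst e).symm
      · exact (congrArg Prod.snd e).symm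

lemma spliceExtend_joined (hc : ∀ d, c ((P.splice v b).opp d) = c d) (j : Fin 4) :
    spliceExtend hv c (v, joined b j) = spliceExtend hv c (v, j) := by
  rw [← spliceExtend_opp hv hc, ← spliceExtend_opp hv hc (v, j), spliceExtend_of_ne hv _ (hv _),
    spliceExtend_of_ne hv _ (hv _), ← hc (⟨(P.opp (v, j)).1, hv j⟩, (P.opp (v, j)).2)]
  congr 1
  have e : P.spliceOpp v b (P.opp (v, j)) = P.opp (v, joined b j) := by
    rw [spliceOpp, P.opp_opp, pass_of_eq, pass_of_ne _ _ (hv _)]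
  refine Prod.ext (Subtype.ext ?_) ?_
  · exact (congrArg Prod.fst e).symm
  · exact (congrArg Prod.snd e).symm

end Extension

/-- An incoherent splice at a crossing that is interlaced with another one produces a single
curve. -/
lemma isSingleCurve_splice (hP : P.IsSingleCurve) {v : P.Crossing} {b : Bool}
    {cv : P.Dart → ZMod 2} (hcv : P.IsLobe v cv)
    (hb : ∀ j, cv (v, joined b j) = cv (v, j) + 1) {u : P.Crossing} (hu : u ≠ v)
    (hcu : cv (u, 2) ≠ cv (u, 3)) : (P.splice v b).IsSingleCurve := by
  classical
  have hv := hcv.opp_fst_ne hP hu hcu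
  have : Nonempty (P.splice v b).Crossing := ⟨⟨u, hu⟩⟩
  refine isSingleCurve_of_forall_eq fun c hopp hstr => ?_
  let C : P.Dart → ZMod 2 := spliceExtend hv fun d => if c d then 1 else 0
  have hC : ∀ d, C (P.opp d) = C d := spliceExtend_opp hv fun d => by simp only [hopp]
  have hCj : ∀ j, C (v, joined b j) = C (v, j) :=
    spliceExtend_joined hv fun d => by simp only [hopp]
  have hCs : ∀ w, w ≠ v → ∀ i, C (w, i + 2) = C (w, i) := fun w hw i => by
    rw [show C (w, i + 2) = _ from spliceExtend_of_ne hv _ hw,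
      show C (w, i) = _ from spliceExtend_of_ne hv _ hw]
    exact congrArg (fun p : Prop => if p then (1 : ZMod 2) else 0) (hstr ⟨w, hw⟩ i)
  have hCc : ∀ d e, C d = C e := by
    by_cases h0 : C (v, 2) = C (v, 0)
    · refine hP.eq_of_straight hC fun w i => ?_
      by_cases hw : w = v
      · subst hw
        have key : ∀ (b : Bool) (x0 x1 x2 x3 : ZMod 2),
            (∀ j, ![x0, x1, x2, x3] (joined b j) = ![x0, x1, x2, x3] j) → x2 = x0 →
            ∀ i, ![x0, x1, x2, x3] (i + 2) = ![x0, x1, x2, x3] i := by decide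
        have e : ∀ j : Fin 4, C (w, j) = ![C (w, 0), C (w, 1), C (w, 2), C (w, 3)] j := by
          intro j; fin_cases j <;> rfl
        have := key b (C (w, 0)) (C (w, 1)) (C (w, 2)) (C (w, 3))
        simp only [← e] at this
        exact this hCj h0 i
      · exact hCs w hw i
    · -- the extension would be a lobe at `v` that is compatible with an incoherent splice
      exfalso
      have hl : P.IsLobe v C := by
        refine ⟨hC, hCs, fun i => ?_⟩
        have key : ∀ (b : Bool) (x0 x1 x2 x3 : ZMod 2),
            (∀ j, ![x0, x1, x2, x3] (joined b j) = ![x0, x1, x2, x3] j) → ¬ x2 = x0 →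
            ∀ i, ![x0, x1, x2, x3] (i + 2) = ![x0, x1, x2, x3] i + 1 := by decide
        have e : ∀ j : Fin 4, C (v, j) = ![C (v, 0), C (v, 1), C (v, 2), C (v, 3)] j := by
          intro j; fin_cases j <;> rfl
        have := key b (C (v, 0)) (C (v, 1)) (C (v, 2)) (C (v, 3))
        simp only [← e] at this
        exact this hCj h0 i
      have := hcv.eq_add hP hl (v, joined b 0) (v, 0)
      rw [hb, hCj] at this
      revert this; generalize cv (v, 0) = x; generalize C (v, 0) = y; revert x y; decide
  intro d e
  have := hCc (spliceDart d) (spliceDart e)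
  simp only [C, spliceExtend_spliceDart] at this
  by_cases hd : c d <;> by_cases he : c e <;> simp_all

/-- A splice preserves exactness: a cycle of the splice, extended to the edges at `v`, is the
boundary of a set of regions of `P` that contains both or neither of the two regions that the
splice merges, so that it is a set of regions of the splice. -/
lemma isExact_splice (hex : P.IsExact) {v : P.Crossing} (b : Bool)
    (hv : ∀ j, (P.opp (v, j)).1 ≠ v) : (P.splice v b).IsExact := by
  intro c hc
  let C : P.Dart → ZMod 2 := spliceExtend hv c
  have hC : ∀ d, C (P.opp d) = C d := spliceExtend_opp hv hc.opp
  have hCj : ∀ j, C (v, joined b j) = C (v, j) := spliceExtend_joined hv hc.opp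
  have hcyc : P.IsCycle C := by
    refine ⟨hC, fun w => ?_⟩
    by_cases hw : w = v
    · subst hw
      rw [Fin.sum_univ_four]
      have key : ∀ (b : Bool) (x0 x1 x2 x3 : ZMod 2),
          (∀ j, ![x0, x1, x2, x3] (joined b j) = ![x0, x1, x2, x3] j) →
          x0 + x1 + x2 + x3 = 0 := by decide
      have e : ∀ j : Fin 4, C (w, j) = ![C (w, 0), C (w, 1), C (w, 2), C (w, 3)] j := by
        intro j; fin_cases j <;> rfl
      have := key b (C (w, 0)) (C (w, 1)) (C (w, 2)) (C (w, 3))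
      simp only [← e] at this
      exact this hCj
    · rw [← hc.sum_eq_zero ⟨w, hw⟩]
      exact Finset.sum_congr rfl fun i _ => spliceExtend_of_ne hv _ hw
  obtain ⟨f, hf, hCf⟩ := hex C hcyc
  have hf' := apply_opp_of_invariant hf
  -- the set of regions does not change from a corner next to a dart `j` at `v` to the corner
  -- next to the dart that is joined to it
  have hcorner : ∀ j, f (v, joined b j) = f (v, j + -1) := by
    have h1 : ∀ j, C (v, j) = f (v, j) + f (v, j + -1) := fun j => by rw [hCf, hf']
    have key : ∀ (b : Bool) (x0 x1 x2 x3 : ZMod 2),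
        (∀ j, ![x0, x1, x2, x3] (joined b j) + ![x0, x1, x2, x3] (joined b j + -1) =
          ![x0, x1, x2, x3] j + ![x0, x1, x2, x3] (j + -1)) →
        ∀ j, ![x0, x1, x2, x3] (joined b j) = ![x0, x1, x2, x3] (j + -1) := by decide
    have e : ∀ j : Fin 4, f (v, j) = ![f (v, 0), f (v, 1), f (v, 2), f (v, 3)] j := by
      intro j; fin_cases j <;> rfl
    have := key b (f (v, 0)) (f (v, 1)) (f (v, 2)) (f (v, 3))
    simp only [← e, ← h1] at this
    exact this hCj
  have hpass : ∀ d, f (P.spliceOpp v b d) = f (P.opp d) := by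
    have h : ∀ d, f (P.pass v b d) = f d := by
      rintro ⟨w, j⟩
      by_cases hw : w = v
      · subst hw
        have := hcorner (joined b j)
        rw [joined_joined] at this
        rw [pass_of_eq, hf', this]
      · rw [pass_of_ne _ _ hw]
    intro d
    rw [spliceOpp, h, h]
  refine ⟨fun d => f (spliceDart d), fun d => ?_, fun d => ?_⟩
  · have h1 : spliceDart ((P.splice v b).boundaryWalk d) =
        P.boundaryWalk (P.opp (P.spliceOpp v b (spliceDart d))) := by
      rw [boundaryWalk_apply, boundaryWalk_apply, P.opp_opp]
      rfl
    have h : ∀ d, f (P.opp (P.pass v b d)) = f (P.opp d) := by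
      rintro ⟨w, j⟩
      by_cases hw : w = v
      · subst hw
        rw [pass_of_eq, P.opp_opp, hcorner, hf']
      · rw [pass_of_ne _ _ hw]
    change f (spliceDart ((P.splice v b).boundaryWalk d)) = f (spliceDart d)
    rw [h1, hf, spliceOpp, h, h, P.opp_opp]
  · change c d = f (spliceDart d) + f (spliceDart ((P.splice v b).opp d))
    rw [spliceDart_opp, hpass, ← hCf]
    exact (spliceExtend_spliceDart hv d).symm

end FourValentMap

/-! ### The reductivity in terms of the interlacement -/

section Graph

variable {V : Type*}

/-- Local complementation of a graph at the vertex `v`, for a graph given by its adjacency matrix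
with entries in `ZMod 2`: the adjacency of any two neighbours of `v` is reversed. Diagonal entries
are irrelevant. -/
def localComplement (a : V → V → ZMod 2) (v : V) (x y : V) : ZMod 2 := a x y + a x v * a v y

/-- The graph on `S` with adjacency matrix `a` gets an isolated vertex by removing `k` vertices one
after the other, each after local complementation at it. -/
def IsolatedAfter : ℕ → Set V → (V → V → ZMod 2) → Prop
  | 0, S, a => ∃ w ∈ S, ∀ u ∈ S, u ≠ w → a w u = 0
  | k + 1, S, a => ∃ v ∈ S, IsolatedAfter k (S \ {v}) (localComplement a v)

end Graph

namespace FourValentMap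

variable {P : FourValentMap} {V : Type*}

/-- The matrix `a`, indexed by a type `V` into which the crossings are embedded by `e`, describes
which pairs of crossings are interlaced: the curve passes through `u` once on each of the two loops
at `v` if and only if `a (e v) (e u) = 1`. -/
def IsInterlacement (P : FourValentMap) (e : P.Crossing → V) (a : V → V → ZMod 2) : Prop :=
  ∀ v, ∃ c, P.IsLobe v c ∧ ∀ u, u ≠ v → c (u, 2) + c (u, 3) = a (e v) (e u)

lemma IsInterlacement.splice {e : P.Crossing → V} {a : V → V → ZMod 2} (ha : P.IsInterlacement e a)
    {v : P.Crossing} {cv : P.Dart → ZMod 2} (hcv : P.IsLobe v cv)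
    (hav : ∀ u, u ≠ v → cv (u, 2) + cv (u, 3) = a (e v) (e u)) {b : Bool}
    (hb : ∀ j, cv (v, joined b j) = cv (v, j) + 1) :
    (P.splice v b).IsInterlacement (fun w => e w.1) (localComplement a (e v)) := by
  rintro ⟨w, hw⟩
  obtain ⟨c, hc, hac⟩ := ha w
  refine ⟨_, hc.splice hw.symm hcv hb, fun u hu => ?_⟩
  have hu' : u.1 ≠ w := fun h => hu (Subtype.ext h)
  rw [localComplement, ← hac u.1 hu', ← hac v hw.symm, ← hav u.1 u.2]
  simp only [spliceDart]
  ring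

end FourValentMap

namespace SphericalCurve

open FourValentMap

variable {V : Type*}

lemma isExact (P : SphericalCurve) : P.IsExact :=
  (isPlanar_iff_isExact P.isSingleCurve).1 P.isPlanar

/-- The operation `I` amounts to local complementation and removal of a vertex of the interlacement
graph, and reducible crossings are isolated vertices. -/
lemma reducibleAfter_iff (k : ℕ) : ∀ (P : SphericalCurve) {e : P.Crossing → V}
    {a : V → V → ZMod 2}, Function.Injective e → P.IsInterlacement e a →
    (∀ j < k, ¬ IsolatedAfter j (Set.range e) a) →
    (ReducibleAfter k P ↔ IsolatedAfter k (Set.range e) a) := by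
  have hzero : ∀ x y : ZMod 2, x + y = 0 ↔ x = y := by decide
  induction k with
  | zero =>
    intro P e a he ha _
    have h : ∀ v, P.IsReducibleCrossing v ↔ ∀ u, u ≠ v → a (e v) (e u) = 0 := fun v => by
      obtain ⟨c, hc, hac⟩ := ha v
      refine (ncard_regionAt_eq_three_iff P.isSingleCurve P.isExact hc).trans ?_
      exact forall₂_congr fun u hu => by rw [← hac u hu, hzero]
    change (∃ v, P.IsReducibleCrossing v) ↔ ∃ w ∈ Set.range e, ∀ u ∈ Set.range e, u ≠ w → a w u = 0
    simp only [h, Set.exists_range_iff, Set.forall_mem_range, ne_eq, he.eq_iff]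
  | succ k ih =>
    intro P e a he ha hmin
    -- no crossing is reducible, so that the splice at any crossing is that of an interlaced one
    have hne : ∀ v c, P.IsLobe v c → (∀ u, u ≠ v → c (u, 2) + c (u, 3) = a (e v) (e u)) →
        ∃ u, u ≠ v ∧ c (u, 2) ≠ c (u, 3) := by
      intro v c hc hac
      by_contra hcon
      refine hmin 0 (Nat.succ_pos k) ⟨e v, ⟨v, rfl⟩, ?_⟩
      rintro _ ⟨u, rfl⟩ hu
      have hu' : u ≠ v := fun h => hu (by rw [h])
      rw [← hac u hu', hzero]
      by_contra h
      exact hcon ⟨u, hu', h⟩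
    have hrange : ∀ v : P.Crossing, Set.range (fun w : {w : P.Crossing // w ≠ v} => e w.1) =
        Set.range e \ {e v} := fun v => by
      ext x
      constructor
      · rintro ⟨w, rfl⟩
        exact ⟨⟨w.1, rfl⟩, fun h => w.2 (he h)⟩
      · rintro ⟨⟨w, rfl⟩, h⟩
        exact ⟨⟨w, fun h' => h (by rw [h']; rfl)⟩, rfl⟩
    have hinj : ∀ v : P.Crossing, Function.Injective
        fun w : {w : P.Crossing // w ≠ v} => e w.1 := fun v x y h => Subtype.ext (he h)
    have hmin' : ∀ v, ∀ j < k, ¬ IsolatedAfter j (Set.range e \ {e v}) (localComplement a (e v)) :=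
      fun v j hj h => hmin (j + 1) (Nat.succ_lt_succ hj) ⟨e v, ⟨v, rfl⟩, h⟩
    constructor
    · rintro ⟨⟨Q, hQ1, hQ2⟩, ⟨v, b, hb, rfl⟩, hred⟩
      obtain ⟨c, hc, hac⟩ := ha v
      have hb' := (hc.incoherent_iff P.isSingleCurve b).1 hb
      refine ⟨e v, ⟨v, rfl⟩, ?_⟩
      rw [← hrange]
      refine (ih _ (hinj v) (ha.splice hc hac hb') ?_).1 hred
      exact fun j hj h => hmin' v j hj (by rwa [← hrange])
    · rintro ⟨_, ⟨v, rfl⟩, hiso⟩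
      obtain ⟨c, hc, hac⟩ := ha v
      obtain ⟨u, hu, hcu⟩ := hne v c hc hac
      obtain ⟨b, hb⟩ := hc.exists_incoherent
      have h1 := isSingleCurve_splice P.isSingleCurve hc hb hu hcu
      have h2 := (isPlanar_iff_isExact h1).2
        (isExact_splice P.isExact b (hc.opp_fst_ne P.isSingleCurve hu hcu))
      refine ⟨⟨P.splice v b, h1, h2⟩, ⟨v, b, (hc.incoherent_iff P.isSingleCurve b).2 hb, rfl⟩, ?_⟩
      refine (ih _ (hinj v) (ha.splice hc hac hb) ?_).2
        ((congrArg (IsolatedAfter k · _) (hrange v)).mpr hiso)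
      exact fun j hj h => hmin' v j hj ((congrArg (IsolatedAfter j · _) (hrange v)).mp h)

lemma reductivity_eq (P : SphericalCurve) {e : P.Crossing → V} {a : V → V → ZMod 2}
    (he : Function.Injective e) (ha : P.IsInterlacement e a) {k : ℕ}
    (hk : IsolatedAfter k (Set.range e) a) (hmin : ∀ j < k, ¬ IsolatedAfter j (Set.range e) a) :
    P.reductivity = k := by
  have h : ∀ j ≤ k, ReducibleAfter j P ↔ IsolatedAfter j (Set.range e) a := fun j hj =>
    reducibleAfter_iff j P he ha fun i hi => hmin i (lt_of_lt_of_le hi hj)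
  refine le_antisymm (iInf₂_le k ((h k le_rfl).2 hk)) (le_iInf₂ fun j hj => ?_)
  by_contra hlt
  have hlt' : j < k := by exact_mod_cast not_le.1 hlt
  exact hmin j hlt' ((h j hlt'.le).1 hj)

end SphericalCurve

section Graph

variable {V : Type*}

lemma localComplement_symm {a : V → V → ZMod 2} (ha : ∀ x y, a x y = a y x) (v x y : V) :
    localComplement a v x y = localComplement a v y x := by
  rw [localComplement, localComplement, ha x y, ha x v, ha v y, mul_comm]

/-- The vertices that are removed form, with the one that gets isolated, a set of which every
other vertex has an even number of neighbours, as soon as those that do not contribute are left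
out. If all of them contribute, then none of them is isolated inside the set. -/
lemma IsolatedAfter.exists_finset {k : ℕ} : ∀ {S : Set V} {a : V → V → ZMod 2},
    (∀ x y, a x y = a y x) → IsolatedAfter k S a →
    ∃ X : Finset V, X.Nonempty ∧ (∀ x ∈ X, x ∈ S) ∧ X.card ≤ k + 1 ∧
      (∀ u ∈ S, u ∉ X → ∑ x ∈ X, a x u = 0) ∧
      (1 < X.card → X.card = k + 1 → ∀ x ∈ X, ∃ y ∈ X, y ≠ x ∧ a x y = 1) := by
  classical
  induction k with
  | zero =>
    rintro S a - ⟨w, hw, h⟩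
    refine ⟨{w}, by simp, by simpa using hw, by simp, fun u hu hX => ?_, by simp⟩
    rw [Finset.sum_singleton]
    exact h u hu (by simpa using hX)
  | succ k ih =>
    rintro S a ha ⟨v, hv, h⟩
    obtain ⟨X, hne, hXS, hcard, hsum, hnb⟩ := ih (localComplement_symm ha v) h
    have hvX : v ∉ X := fun h => (hXS v h).2 rfl
    have hsum' : ∀ u ∈ S, u ≠ v → u ∉ X →
        ∑ x ∈ X, a x u + (∑ x ∈ X, a x v) * a v u = 0 := fun u hu huv huX => by
      rw [Finset.sum_mul, ← Finset.sum_add_distrib]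
      exact hsum u ⟨hu, huv⟩ huX
    have h01 : ∀ x : ZMod 2, x ≠ 0 → x = 1 := by decide
    by_cases hs : ∑ x ∈ X, a x v = 0
    · refine ⟨X, hne, fun x hx => (hXS x hx).1, by omega, fun u hu huX => ?_, fun _ _ => by omega⟩
      by_cases huv : u = v
      · rw [huv, hs]
      · have := hsum' u hu huv huX
        rwa [hs, zero_mul, add_zero] at this
    · have hs1 := h01 _ hs
      refine ⟨insert v X, by simp, ?_, ?_, fun u hu huX => ?_, fun _ hc => ?_⟩
      · intro x hx
        rcases Finset.mem_insert.1 hx with rfl | hx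
        · exact hv
        · exact (hXS x hx).1
      · rw [Finset.card_insert_of_notMem hvX]; omega
      · rw [Finset.mem_insert, not_or] at huX
        rw [Finset.sum_insert hvX, add_comm]
        have := hsum' u hu huX.1 huX.2
        rwa [hs1, one_mul] at this
      · rw [Finset.card_insert_of_notMem hvX] at hc
        intro x hx
        rcases Finset.mem_insert.1 hx with rfl | hx
        · obtain ⟨y, hy, hy0⟩ := Finset.exists_ne_zero_of_sum_ne_zero hs
          exact ⟨y, Finset.mem_insert_of_mem hy, fun h => hvX (h ▸ hy), by rw [ha, h01 _ hy0]⟩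
        · have hxv : v ≠ x := fun h => hvX (h ▸ hx)
          by_cases h1 : a x v = 1
          · exact ⟨v, Finset.mem_insert_self _ _, hxv, h1⟩
          · by_cases hX1 : 1 < X.card
            · obtain ⟨y, hy, hyx, hxy⟩ := hnb hX1 (by omega) x hx
              have h0 : a x v = 0 := by
                by_contra h0
                exact h1 (h01 _ h0)
              rw [localComplement, h0, zero_mul, add_zero] at hxy
              exact ⟨y, Finset.mem_insert_of_mem hy, hyx, hxy⟩
            · obtain ⟨z, hz⟩ := Finset.card_eq_one.1 (show X.card = 1 by
                have := hne.card_pos; omega)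
              rw [hz, Finset.mem_singleton] at hx
              rw [hz, Finset.sum_singleton, ← hx] at hs1
              exact absurd hs1 h1

/-- Three vertices that form a path and of which every other vertex has an even number of
neighbours. -/
lemma isolatedAfter_two_of_path {S : Set V} {a : V → V → ZMod 2} {x y z : V}
    (hx : x ∈ S) (hy : y ∈ S) (hz : z ∈ S) (hxy : y ≠ x) (hzx : z ≠ x) (hzy : z ≠ y)
    (ayx : a y x = 1) (azx : a z x = 0) (azy : a z y = 1)
    (h : ∀ u ∈ S, u ≠ x → u ≠ y → u ≠ z → a x u + a y u + a z u = 0) : IsolatedAfter 2 S a := by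
  refine ⟨x, hx, y, ⟨hy, hxy⟩, z, ⟨⟨hz, hzx⟩, hzy⟩, fun u hu huz => ?_⟩
  rw [← h u hu.1.1 hu.1.2 hu.2 huz]
  simp only [localComplement, ayx, azx, azy]
  ring

end Graph

namespace TorusProjection

open FourValentMap

/-! ### The interlacement of the standard projection of a torus knot -/

variable {m q : ℕ}

/-- The time at which the strand that moves to the right passes through a crossing. A period of
the curve takes `2 m` units of time: `m` steps to the right in the `j`-th factor of the braid and
`m` steps to the left; the next period starts in the factor `j + (m + 1)`. Here `t` is the inverse
of `m + 1` in `ZMod q`, so that the period that starts in the `j`-th factor is the period number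
`t * j`. -/
def timeRight (m q : ℕ) (t : ZMod q) (c : ZMod q × Fin m) : ℕ := 2 * m * (t * c.1).val + c.2

/-- The time at which the strand that moves to the left passes through a crossing. -/
def timeLeft (m q : ℕ) (t : ZMod q) (c : ZMod q × Fin m) : ℕ :=
  2 * m * (t * (c.1 + (c.2 : ℕ) - m)).val + (2 * m - 1 - c.2)

/-- The number of passages through `c`, modulo `2`, up to the time `s`. -/
def passages (m q : ℕ) (t : ZMod q) (c : ZMod q × Fin m) (s : ℕ) : ZMod 2 :=
  (if timeRight m q t c ≤ s then 1 else 0) + (if timeLeft m q t c ≤ s then 1 else 0)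

/-- The interlacement matrix of the closed braid. -/
def interlace (m q : ℕ) (t : ZMod q) (c c' : ZMod q × Fin m) : ZMod 2 :=
  passages m q t c (timeRight m q t c') + passages m q t c (timeLeft m q t c')

/-- The time at which the curve, directed upwards, enters an edge. -/
def edgeTime (m q : ℕ) (t : ZMod q) : (ZMod q × Fin m) × Fin 4 → ℕ
  | ((j, i), 0) => if h : i.1 = 0 then timeLeft m q t (j - 1, i)
      else timeRight m q t (j, ⟨i.1 - 1, by omega⟩)
  | ((j, i), 1) => if h : i.1 + 1 < m then timeLeft m q t (j - 1, ⟨i.1 + 1, h⟩)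
      else timeRight m q t (j - 1, i)
  | (c, 2) => timeRight m q t c
  | (c, 3) => timeLeft m q t c

lemma edgeTime_opp (t : ZMod q) (d : (ZMod q × Fin m) × Fin 4) :
    edgeTime m q t (opp m q d) = edgeTime m q t d := by
  obtain ⟨⟨j, i, hi⟩, k⟩ := d
  fin_cases k
  · by_cases h : i = 0 <;> simp [opp, edgeTime, h]
  · by_cases h : i + 1 < m <;> simp [opp, edgeTime, h]
  · by_cases h : i + 1 < m <;> simp [opp, edgeTime, h]
  · by_cases h : i = 0
    · simp [opp, edgeTime, h]
    · have h' : i - 1 + 1 = i := by omega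
      simp [opp, edgeTime, h, h', hi]

lemma val_add_one_cases [NeZero q] (x : ZMod q) :
    (x + 1).val = x.val + 1 ∨ ((x + 1).val = 0 ∧ x.val + 1 = q) := by
  have h : (x + 1).val = (x.val + 1) % q := by
    rw [← ZMod.val_natCast, Nat.cast_add, ZMod.natCast_zmod_val, Nat.cast_one]
  have hx := ZMod.val_lt x
  rcases Nat.lt_or_ge (x.val + 1) q with h1 | h1
  · left; rw [h, Nat.mod_eq_of_lt h1]
  · have : x.val + 1 = q := by omega
    right; rw [h, this, Nat.mod_self]; exact ⟨rfl, rfl⟩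

lemma timeRight_lt [NeZero q] (t : ZMod q) (c : ZMod q × Fin m) :
    timeRight m q t c < 2 * m * q := by
  have h1 := ZMod.val_lt (t * c.1)
  have h2 : 2 * m * ((t * c.1).val + 1) ≤ 2 * m * q := Nat.mul_le_mul_left _ h1
  have h3 := c.2.2
  rw [timeRight]
  rw [mul_add, mul_one] at h2
  omega

lemma timeLeft_lt [NeZero q] (t : ZMod q) (c : ZMod q × Fin m) :
    timeLeft m q t c < 2 * m * q := by
  have h1 := ZMod.val_lt (t * (c.1 + ((c.2 : ℕ) : ZMod q) - (m : ZMod q)))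
  have h2 : 2 * m * ((t * (c.1 + ((c.2 : ℕ) : ZMod q) - (m : ZMod q))).val + 1) ≤ 2 * m * q :=
    Nat.mul_le_mul_left _ h1
  have h3 := c.2.2
  rw [timeLeft]
  rw [mul_add, mul_one] at h2
  omega

lemma eq_and_eq_of_mul_add {n A B i j : ℕ} (hi : i < n) (hj : j < n)
    (h : n * A + i = n * B + j) : A = B ∧ i = j := by
  have h1 := congrArg (· / n) h
  have h2 := congrArg (· % n) h
  have hn : 0 < n := by omega
  simp only [Nat.mul_add_div hn, Nat.div_eq_of_lt hi, Nat.div_eq_of_lt hj, Nat.mul_add_mod,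
    Nat.mod_eq_of_lt hi, Nat.mod_eq_of_lt hj, add_zero] at h1 h2
  exact ⟨h1, h2⟩

lemma eq_of_mul_eq {t : ZMod q} (ht : t * (m + 1 : ℕ) = 1) {x y : ZMod q} (h : t * x = t * y) :
    x = y := by
  linear_combination ((m + 1 : ℕ) : ZMod q) * h - (x - y) * ht

lemma timeRight_injective [NeZero q] {t : ZMod q} (ht : t * (m + 1 : ℕ) = 1) :
    Function.Injective (timeRight m q t) := by
  rintro ⟨j, i, hi⟩ ⟨j', i', hi'⟩ h
  obtain ⟨h1, h2⟩ := eq_and_eq_of_mul_add (n := 2 * m) (by dsimp only; omega)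
    (by dsimp only; omega) h
  have h3 := eq_of_mul_eq ht (ZMod.val_injective q h1)
  dsimp only at h2 h3
  subst h2 h3
  rfl

lemma timeLeft_injective [NeZero q] {t : ZMod q} (ht : t * (m + 1 : ℕ) = 1) :
    Function.Injective (timeLeft m q t) := by
  rintro ⟨j, i, hi⟩ ⟨j', i', hi'⟩ h
  obtain ⟨h1, h2⟩ := eq_and_eq_of_mul_add (n := 2 * m) (by dsimp only; omega)
    (by dsimp only; omega) h
  have h3 := eq_of_mul_eq ht (ZMod.val_injective q h1)
  dsimp only at h2 h3
  obtain rfl : i = i' := by omega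
  obtain rfl : j = j' := by linear_combination h3
  rfl

lemma timeRight_ne_timeLeft (t : ZMod q) (c c' : ZMod q × Fin m) :
    timeRight m q t c ≠ timeLeft m q t c' := by
  intro h
  have h1 := c.2.2
  have h2 := c'.2.2
  obtain ⟨-, h3⟩ := eq_and_eq_of_mul_add (n := 2 * m) (by omega) (by omega) h
  omega

lemma interlace_symm [NeZero q] {t : ZMod q} (ht : t * (m + 1 : ℕ) = 1) (c c' : ZMod q × Fin m) :
    interlace m q t c c' = interlace m q t c' c := by
  by_cases hc : c = c'
  · rw [hc]
  · have h1 : timeRight m q t c ≠ timeRight m q t c' := (timeRight_injective ht).ne hc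
    have h2 : timeLeft m q t c ≠ timeLeft m q t c' := (timeLeft_injective ht).ne hc
    have h3 := timeRight_ne_timeLeft t c c'
    have h4 := timeRight_ne_timeLeft t c' c
    have key : ∀ {x y : ℕ}, x ≠ y →
        (if x ≤ y then (1 : ZMod 2) else 0) = (if y ≤ x then 1 else 0) + 1 := by
      intro x y hxy
      rcases Nat.lt_or_gt_of_ne hxy with h | h
      · rw [if_pos h.le, if_neg (by omega), zero_add]
      · rw [if_neg (by omega), if_pos h.le]; rfl
    simp only [interlace, passages]
    rw [key h1, key h2, key h3, key h4.symm]
    generalize (if timeRight m q t c' ≤ timeRight m q t c then (1 : ZMod 2) else 0) = x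
    generalize (if timeLeft m q t c' ≤ timeLeft m q t c then (1 : ZMod 2) else 0) = y
    generalize (if timeLeft m q t c' ≤ timeRight m q t c then (1 : ZMod 2) else 0) = z
    generalize (if timeRight m q t c' ≤ timeLeft m q t c then (1 : ZMod 2) else 0) = w
    revert x y z w; decide

lemma edgeTime_zero [NeZero q] {t : ZMod q} (ht : t * (m + 1 : ℕ) = 1) (c : ZMod q × Fin m) :
    timeRight m q t c = edgeTime m q t (c, 0) + 1 ∨
      (timeRight m q t c = 0 ∧ edgeTime m q t (c, 0) + 1 = 2 * m * q) := by
  obtain ⟨j, i, hi⟩ := c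
  by_cases h : i = 0
  · subst h
    have e : t * j = t * (j - 1 + ((0 : ℕ) : ZMod q) - m) + 1 := by
      push_cast at ht ⊢
      linear_combination ht
    simp only [edgeTime, dite_true, timeRight, timeLeft]
    rw [e]
    rcases val_add_one_cases (t * (j - 1 + ((0 : ℕ) : ZMod q) - (m : ZMod q))) with h | ⟨h, h'⟩
    · left; rw [h, mul_add]; omega
    · right; rw [h]; refine ⟨by simp, ?_⟩
      conv_rhs => rw [← h', mul_add]
      omega
  · left
    simp only [edgeTime, h, dite_false, timeRight]
    omega

lemma edgeTime_one (t : ZMod q) (c : ZMod q × Fin m) :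
    timeLeft m q t c = edgeTime m q t (c, 1) + 1 := by
  obtain ⟨j, i, hi⟩ := c
  by_cases h : i + 1 < m
  · have e : j - 1 + ((i + 1 : ℕ) : ZMod q) - m = j + (i : ZMod q) - m := by push_cast; ring
    simp only [edgeTime, h, dite_true, timeLeft, e]
    omega
  · obtain rfl : m = i + 1 := by omega
    have e : j - 1 = j + (i : ZMod q) - ((i + 1 : ℕ) : ZMod q) := by push_cast; ring
    simp only [edgeTime, h, dite_false, timeLeft, timeRight, e]
    omega

lemma passages_succ [NeZero q] (t : ZMod q) (c : ZMod q × Fin m) {x y : ℕ}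
    (h : y = x + 1 ∨ (y = 0 ∧ x + 1 = 2 * m * q)) :
    passages m q t c y = passages m q t c x + (if timeRight m q t c = y then 1 else 0) +
      (if timeLeft m q t c = y then 1 else 0) := by
  have h1 := timeRight_lt t c
  have h2 := timeLeft_lt t c
  have key : ∀ {s : ℕ}, s < 2 * m * q → (if s ≤ y then (1 : ZMod 2) else 0) =
      (if s ≤ x then 1 else 0) + (if s = y then 1 else 0) + (if y = 0 then 1 else 0) := by
    intro s hs
    rcases h with h | ⟨h, h'⟩
    · rw [if_neg (show ¬ y = 0 by omega)]
      rcases Nat.lt_trichotomy s y with h3 | h3 | h3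
      · rw [if_pos h3.le, if_pos (by omega), if_neg (by omega)]; rfl
      · rw [if_pos h3.le, if_neg (by omega), if_pos h3]; rfl
      · rw [if_neg (by omega), if_neg (by omega), if_neg (by omega)]; rfl
    · rw [if_pos h, if_pos (show s ≤ x by omega)]
      by_cases h3 : s = y
      · rw [if_pos h3.le, if_pos h3]; rfl
      · rw [if_neg (by omega), if_neg h3]; rfl
  simp only [passages]
  rw [key h1, key h2]
  generalize (if y = 0 then (1 : ZMod 2) else 0) = z
  have hz : z + z = 0 := CharTwo.add_self_eq_zero z
  linear_combination hz

/-- The loops at a crossing of the closed braid consist of the edges that the curve enters between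
the two passages through the crossing, and of the other ones. -/
lemma isLobe_passages [NeZero q] {t : ZMod q} (ht : t * (m + 1 : ℕ) = 1) (c : ZMod q × Fin m) :
    (closedBraidMap m q).IsLobe c fun d => passages m q t c (edgeTime m q t d) := by
  have h20 : ∀ u : ZMod q × Fin m, passages m q t c (edgeTime m q t (u, 2)) =
      passages m q t c (edgeTime m q t (u, 0)) + (if u = c then 1 else 0) := by
    intro u
    change passages m q t c (timeRight m q t u) = _
    rw [passages_succ t c (edgeTime_zero ht u), if_neg (timeRight_ne_timeLeft t u c).symm,
      add_zero]
    simp only [(timeRight_injective ht).eq_iff, eq_comm]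
  have h31 : ∀ u : ZMod q × Fin m, passages m q t c (edgeTime m q t (u, 3)) =
      passages m q t c (edgeTime m q t (u, 1)) + (if u = c then 1 else 0) := by
    intro u
    change passages m q t c (timeLeft m q t u) = _
    rw [passages_succ t c (Or.inl (edgeTime_one t u)), if_neg (timeRight_ne_timeLeft t c u),
      add_zero]
    simp only [(timeLeft_injective ht).eq_iff, eq_comm]
  have h2 : ∀ u : ZMod q × Fin m, ∀ i, passages m q t c (edgeTime m q t (u, i + 2)) =
      passages m q t c (edgeTime m q t (u, i)) + (if u = c then 1 else 0) := by
    intro u i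
    have key : ∀ x y z : ZMod 2, x = y + z → y = x + z := by decide
    fin_cases i
    · exact h20 u
    · exact h31 u
    · exact key _ _ _ (h20 u)
    · exact key _ _ _ (h31 u)
  refine ⟨fun d => ?_, fun u hu i => ?_, fun i => ?_⟩
  · exact congrArg _ (edgeTime_opp t d)
  · exact (h2 u i).trans ((congrArg _ (if_neg hu)).trans (add_zero _))
  · exact (h2 c i).trans (congrArg _ (if_pos rfl))

lemma isInterlacement [NeZero q] {t : ZMod q} (ht : t * (m + 1 : ℕ) = 1) :
    (closedBraidMap m q).IsInterlacement id (interlace m q t) :=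
  fun c => ⟨_, isLobe_passages ht c, fun _ _ => rfl⟩

lemma reductivity_eq {m q k : ℕ} {hm : 2 ≤ m + 1} {hq : 1 ≤ q} {h : (m + 1).Coprime q}
    {t : ZMod q} (ht : t * (m + 1 : ℕ) = 1) (hk : IsolatedAfter k Set.univ (interlace m q t))
    (hmin : ∀ j < k, ¬ IsolatedAfter j Set.univ (interlace m q t)) :
    (torusKnotProjection (m + 1) q hm hq h).reductivity = k := by
  have : NeZero q := ⟨by omega⟩
  rw [← Set.range_id] at hk hmin
  exact SphericalCurve.reductivity_eq (torusKnotProjection (m + 1) q hm hq h) (e := id)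
    Function.injective_id (isInterlacement ht) hk hmin

end TorusProjection

/-! ### Small cuts -/

namespace FourValentMap

variable {P : FourValentMap}

/-- A division of the edges into two parts that meet only at the crossings in `X`; at these, each
of the two strands passes from one part to the other. -/
structure IsCut (X : Finset P.Crossing) (F : P.Dart → ZMod 2) : Prop where
  opp : ∀ d, F (P.opp d) = F d
  const : ∀ u, u ∉ X → ∀ k, F (u, k) = F (u, 2)
  switch : ∀ x ∈ X, ∀ k, F (x, k + 2) = F (x, k) + 1

/-- A set of crossings such that every other crossing is interlaced with an even number of them
gives a cut. -/
lemma IsInterlacement.exists_isCut {a : P.Crossing → P.Crossing → ZMod 2}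
    (ha : P.IsInterlacement id a) {X : Finset P.Crossing}
    (hX : ∀ u, u ∉ X → ∑ x ∈ X, a x u = 0) : ∃ F, P.IsCut X F := by
  classical
  choose c hc hac using ha
  refine ⟨fun d => ∑ x ∈ X, c x d, fun d => ?_, fun u hu => ?_, fun x hx k => ?_⟩
  · exact Finset.sum_congr rfl fun x _ => (hc x).opp d
  · have hne : ∀ x ∈ X, u ≠ x := fun x hx h => hu (h ▸ hx)
    have h : ∑ x ∈ X, c x (u, 2) + ∑ x ∈ X, c x (u, 3) = 0 := by
      rw [← Finset.sum_add_distrib, ← hX u hu]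
      exact Finset.sum_congr rfl fun x hx => hac x u (hne x hx)
    have h0 : ∑ x ∈ X, c x (u, 2) = ∑ x ∈ X, c x (u, 0) :=
      Finset.sum_congr rfl fun x hx => (hc x).straight u (hne x hx) 0
    have h1 : ∑ x ∈ X, c x (u, 3) = ∑ x ∈ X, c x (u, 1) :=
      Finset.sum_congr rfl fun x hx => (hc x).straight u (hne x hx) 1
    have h3 : ∑ x ∈ X, c x (u, 3) = ∑ x ∈ X, c x (u, 2) := by
      have key : ∀ x y : ZMod 2, x + y = 0 → y = x := by decide
      exact key _ _ h
    intro k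
    fin_cases k
    · exact h0.symm
    · exact h1.symm.trans h3
    · rfl
    · exact h3
  · rw [← Finset.add_sum_erase X (fun y => c y (x, k + 2)) hx,
      ← Finset.add_sum_erase X (fun y => c y (x, k)) hx, (hc x).switch, add_right_comm]
    congr 2
    exact Finset.sum_congr rfl fun y hy => (hc y).straight x (Finset.ne_of_mem_erase hy).symm k

lemma IsCut.eq_of_opp {X : Finset P.Crossing} {F : P.Dart → ZMod 2} (h : P.IsCut X F)
    {u w : P.Crossing} {k k' : Fin 4} (he : P.opp (u, k) = (w, k')) (hu : u ∉ X) (hw : w ∉ X) :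
    F (u, 2) = F (w, 2) := by
  rw [← h.const u hu k, ← h.const w hw k', ← he, h.opp]

/-- If the complement of `X` lies in one part of the cut, then every crossing in `X` has
a neighbour in `X` on each of its two strands. -/
lemma IsCut.exists_neighbour {X : Finset P.Crossing} {F : P.Dart → ZMod 2} (h : P.IsCut X F)
    {γ : ZMod 2} (hγ : ∀ u, u ∉ X → F (u, 2) = γ) {x : P.Crossing} (hx : x ∈ X) (k : Fin 4) :
    (P.opp (x, k)).1 ∈ X ∨ (P.opp (x, k + 2)).1 ∈ X := by
  by_contra hcon
  rw [not_or] at hcon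
  have key : ∀ k, (P.opp (x, k)).1 ∉ X → F (x, k) = γ := fun k hk => by
    rw [← h.opp, ← hγ _ hk]
    exact h.const _ hk _
  have h1 := h.switch x hx k
  rw [key _ hcon.1, key _ hcon.2] at h1
  have hne : ∀ y : ZMod 2, y ≠ y + 1 := by decide
  exact hne _ h1

end FourValentMap

section Columns

variable {V : Type*} {X : Finset V} {q : ℕ}

lemma three_le_card {x y z : V} (hx : x ∈ X) (hy : y ∈ X) (hz : z ∈ X)
    (hxy : x ≠ y) (hxz : x ≠ z) (hyz : y ≠ z) : 3 ≤ X.card :=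
  Finset.two_lt_card.2 ⟨x, hx, y, hy, z, hz, hxy, hxz, hyz⟩

lemma four_le_card {x y z w : V} (hx : x ∈ X) (hy : y ∈ X) (hz : z ∈ X) (hw : w ∈ X)
    (hxy : x ≠ y) (hxz : x ≠ z) (hyz : y ≠ z) (hxw : x ≠ w) (hyw : y ≠ w) (hzw : z ≠ w) :
    4 ≤ X.card := by
  classical
  have h1 : ({x, y, z, w} : Finset V) ⊆ X := by
    intro v hv
    simp only [Finset.mem_insert, Finset.mem_singleton] at hv
    rcases hv with rfl | rfl | rfl | rfl <;> assumption
  have h2 : ({x, y, z, w} : Finset V).card = 4 := by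
    rw [Finset.card_insert_of_notMem (by simp [hxy, hxz, hxw]),
      Finset.card_insert_of_notMem (by simp [hyz, hyw]), Finset.card_pair hzw]
  exact h2 ▸ Finset.card_le_card h1

/-- A cycle remains connected when one vertex is removed. -/
lemma exists_color_of_column [NeZero q] (hq : (1 : ZMod q) ≠ 0) {G : V → ZMod 2} {C : ZMod q → V}
    (hC : ∀ j, C j ∉ X → C (j + 1) ∉ X → G (C j) = G (C (j + 1))) {j₀ : ZMod q}
    (h₀ : ∀ j, j ≠ j₀ → C j ∉ X) : ∃ γ, ∀ j, C j ∉ X → G (C j) = γ := by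
  have h1 : j₀ + 1 ≠ j₀ := fun h => hq (by linear_combination h)
  refine ⟨G (C (j₀ + 1)), ?_⟩
  have key : ∀ t : ℕ, t + 1 < q → G (C (j₀ + 1 + t)) = G (C (j₀ + 1)) := by
    intro t
    induction t with
    | zero => intro _; simp
    | succ t ih =>
      intro ht
      have hne : ∀ s : ℕ, 0 < s → s < q → j₀ + s ≠ j₀ := by
        intro s hs hsq h
        have h2 : (s : ZMod q) = 0 := by linear_combination h
        rw [ZMod.natCast_eq_zero_iff] at h2
        exact absurd (Nat.le_of_dvd hs h2) (by omega)
      rw [← ih (by omega)]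
      have e1 : j₀ + 1 + ((t + 1 : ℕ) : ZMod q) = j₀ + 1 + t + 1 := by push_cast; ring
      have e2 := hne (t + 1) (by omega) (by omega)
      have e3 := hne (t + 2) (by omega) (by omega)
      rw [e1]
      refine (hC _ (h₀ _ ?_) (h₀ _ ?_)).symm
      · intro h; exact e2 (by rw [← h]; push_cast; linear_combination h)
      · intro h; exact e3 (by rw [← h]; push_cast; linear_combination h)
  intro j hj
  by_cases hj0 : j = j₀
  · subst hj0
    exact hC j hj (h₀ _ h1)
  · have e : j = j₀ + 1 + ((j - j₀ - 1).val : ZMod q) := by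
      rw [ZMod.natCast_zmod_val]; ring
    have hlt := ZMod.val_lt (j - j₀ - 1)
    have hne : (j - j₀ - 1).val + 1 ≠ q := by
      intro h
      have h2 := congrArg (Nat.cast (R := ZMod q)) h
      rw [Nat.cast_add, ZMod.natCast_zmod_val, ZMod.natCast_self] at h2
      exact hj0 (by push_cast at h2; linear_combination h2)
    rw [e]
    exact key _ (by omega)

/-- A column next to one that meets `X` in at most one crossing has the same colour. -/
lemma color_of_adjacent_column (hq : (1 : ZMod q) ≠ 0) {G : V → ZMod 2} {B C : ZMod q → V}
    {γ : ZMod 2} (hBC : ∀ j, B j ∉ X → C j ∉ X → G (B j) = G (C j))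
    (hBC' : ∀ j, B j ∉ X → C (j + 1) ∉ X → G (B j) = G (C (j + 1))) {j₀ : ZMod q}
    (h₀ : ∀ j, j ≠ j₀ → C j ∉ X) (hγ : ∀ j, C j ∉ X → G (C j) = γ) (j : ZMod q) (hj : B j ∉ X) :
    G (B j) = γ := by
  by_cases hj0 : j = j₀
  · have h1 : j + 1 ≠ j₀ := fun h => hq (by linear_combination h - hj0)
    rw [hBC' j hj (h₀ _ h1), hγ _ (h₀ _ h1)]
  · rw [hBC j hj (h₀ _ hj0), hγ _ (h₀ _ hj0)]

lemma exists_pair_of_not {C : ZMod q → V} (h : ¬ ∃ j₀, ∀ j, j ≠ j₀ → C j ∉ X) :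
    ∃ j j', j ≠ j' ∧ C j ∈ X ∧ C j' ∈ X := by
  simp only [not_exists, not_forall, not_not] at h
  obtain ⟨j, -, hj⟩ := h 0
  obtain ⟨j', hj', hj''⟩ := h j
  exact ⟨j, j', hj'.symm, hj, hj''⟩

/-- Three columns `A`, `B` and `C`, where `A` and `C` are cycles and `B j` is adjacent to `A j`,
`A (j + 1)`, `C j` and `C (j + 1)`, remain connected when `X` is removed, provided `C` meets `X` in
at most one vertex. -/
lemma exists_color_of_three_columns [NeZero q] (h1 : (1 : ZMod q) ≠ 0) (h2 : (2 : ZMod q) ≠ 0)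
    (hX : X.card ≤ 3) (h3 : (3 : ZMod q) ≠ 0 ∨ X.card ≤ 2) {G : V → ZMod 2} {A B C : ZMod q → V}
    (hA : Function.Injective A) (hB : Function.Injective B) (hAB : ∀ j j', A j ≠ B j')
    (eA : ∀ j, A j ∉ X → A (j + 1) ∉ X → G (A j) = G (A (j + 1)))
    (eC : ∀ j, C j ∉ X → C (j + 1) ∉ X → G (C j) = G (C (j + 1)))
    (eBA : ∀ j, B j ∉ X → A j ∉ X → G (B j) = G (A j))
    (eBA' : ∀ j, B j ∉ X → A (j + 1) ∉ X → G (B j) = G (A (j + 1)))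
    (eBC : ∀ j, B j ∉ X → C j ∉ X → G (B j) = G (C j))
    (eBC' : ∀ j, B j ∉ X → C (j + 1) ∉ X → G (B j) = G (C (j + 1)))
    {j₀ : ZMod q} (h₀ : ∀ j, j ≠ j₀ → C j ∉ X) :
    ∃ γ, ∀ j, (A j ∉ X → G (A j) = γ) ∧ (B j ∉ X → G (B j) = γ) ∧ (C j ∉ X → G (C j) = γ) := by
  obtain ⟨γ, hγ⟩ := exists_color_of_column h1 eC h₀
  have hγB := color_of_adjacent_column h1 eBC eBC' h₀ hγ
  refine ⟨γ, fun j => ⟨fun hj => ?_, hγB j, hγ j⟩⟩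
  have hA1 : ∀ j, A j ∉ X → B j ∉ X → G (A j) = γ := fun j ha hb => by rw [← eBA j hb ha, hγB j hb]
  have hA2 : ∀ j, A (j + 1) ∉ X → B j ∉ X → G (A (j + 1)) = γ := fun j ha hb => by
    rw [← eBA' j hb ha, hγB j hb]
  have e : j - 1 + 1 = j := by ring
  have e' : j - 2 + 1 = j - 1 := by ring
  have hA2' := hA2 (j - 1)
  have hA2'' := hA2 (j - 2)
  rw [e] at hA2'
  rw [e'] at hA2''
  by_cases b0 : B j ∈ X
  · by_cases b1 : B (j - 1) ∈ X
    · have n1 : B j ≠ B (j - 1) := hB.ne fun h => h1 (by linear_combination h)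
      have n2 : B j ≠ B (j + 1) := hB.ne fun h => h1 (by linear_combination -h)
      have n3 : B (j - 1) ≠ B (j + 1) := hB.ne fun h => h2 (by linear_combination -h)
      -- at most one more vertex is removed, and on one side of `A j` the path along the column
      -- `A` and then to the column `B` avoids it
      by_cases a1 : A (j + 1) ∉ X ∧ B (j + 1) ∉ X
      · rw [eA j hj a1.1, hA1 _ a1.1 a1.2]
      · by_cases a2 : A (j - 1) ∉ X ∧ B (j - 2) ∉ X
        · have := eA (j - 1) a2.1
          rw [e] at this
          rw [← this hj, hA2'' a2.1 a2.2]
        · exfalso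
          have hcard : 4 ≤ X.card ∨ ((3 : ZMod q) = 0 ∧ 3 ≤ X.card) := by
            have n4 : A (j - 1) ≠ A (j + 1) := hA.ne fun h => h2 (by linear_combination -h)
            have n5 : B j ≠ B (j - 2) := hB.ne fun h => h2 (by linear_combination h)
            have n6 : B (j - 1) ≠ B (j - 2) := hB.ne fun h => h1 (by linear_combination h)
            rw [not_and_or, not_not, not_not] at a1 a2
            rcases a1 with a1 | a1 <;> rcases a2 with a2 | a2
            · exact Or.inl (four_le_card b0 b1 a1 a2 n1 (hAB _ _).symm (hAB _ _).symm
                (hAB _ _).symm (hAB _ _).symm n4.symm)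
            · exact Or.inl (four_le_card b0 b1 a1 a2 n1 (hAB _ _).symm (hAB _ _).symm n5 n6
                (hAB _ _))
            · exact Or.inl (four_le_card b0 b1 a1 a2 n1 n2 n3 (hAB _ _).symm (hAB _ _).symm
                (hAB _ _).symm)
            · by_cases h : B (j + 1) = B (j - 2)
              · exact Or.inr ⟨by linear_combination hB h, three_le_card b0 b1 a1 n1 n2 n3⟩
              · exact Or.inl (four_le_card b0 b1 a1 a2 n1 n2 n3 n5 n6 h)
          rcases hcard with h | ⟨h, h'⟩
          · omega
          · rcases h3 with h3 | h3
            · exact h3 h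
            · omega
    · exact hA2' hj b1
  · exact hA1 j hj b0

end Columns

namespace TorusProjection

open FourValentMap

/-! ### Small cuts of the standard projections on three and four strands -/

variable {q : ℕ} [NeZero q]

/-- The closed braid on three strands has no cut at one or two crossings, unless it has bigons. -/
lemma eq_empty_of_isCut_two (h1 : (1 : ZMod q) ≠ 0) (h2 : (2 : ZMod q) ≠ 0)
    {X : Finset (ZMod q × Fin 2)} {F : (ZMod q × Fin 2) × Fin 4 → ZMod 2}
    (hF : (closedBraidMap 2 q).IsCut X F) (hX : X.card ≤ 2) : X = ∅ := by
  let A : ZMod q → ZMod q × Fin 2 := fun j => (j, 0)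
  let B : ZMod q → ZMod q × Fin 2 := fun j => (j, 1)
  have hA : Function.Injective A := fun j j' h => congrArg Prod.fst h
  have hB : Function.Injective B := fun j j' h => congrArg Prod.fst h
  have hAB : ∀ j j', A j ≠ B j' := fun j j' => by simp [A, B]
  have eA : ∀ j, A j ∉ X → A (j + 1) ∉ X → F (A j, 2) = F (A (j + 1), 2) := fun j =>
    hF.eq_of_opp (k := 3) (k' := 0) rfl
  have eB : ∀ j, B j ∉ X → B (j + 1) ∉ X → F (B j, 2) = F (B (j + 1), 2) := fun j =>
    hF.eq_of_opp (k := 2) (k' := 1) rfl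
  have eBA : ∀ j, B j ∉ X → A j ∉ X → F (B j, 2) = F (A j, 2) := fun j =>
    hF.eq_of_opp (k := 0) (k' := 2) rfl
  have eBA' : ∀ j, B j ∉ X → A (j + 1) ∉ X → F (B j, 2) = F (A (j + 1), 2) := fun j =>
    hF.eq_of_opp (k := 3) (k' := 1) rfl
  have hcol : ∃ γ, ∀ u, u ∉ X → F (u, 2) = γ := by
    have hsplit : ∀ γ, (∀ j, A j ∉ X → F (A j, 2) = γ) → (∀ j, B j ∉ X → F (B j, 2) = γ) →
        ∀ u, u ∉ X → F (u, 2) = γ := by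
      rintro γ ha hb ⟨j, i⟩
      fin_cases i
      · exact ha j
      · exact hb j
    by_cases hcA : ∃ j₀, ∀ j, j ≠ j₀ → A j ∉ X
    · obtain ⟨j₀, h₀⟩ := hcA
      obtain ⟨γ, hγ⟩ := exists_color_of_column (G := fun u => F (u, 2)) h1 eA h₀
      exact ⟨γ, hsplit γ hγ (color_of_adjacent_column (G := fun u => F (u, 2)) h1 eBA eBA' h₀ hγ)⟩
    · by_cases hcB : ∃ j₀, ∀ j, j ≠ j₀ → B j ∉ X
      · obtain ⟨j₀, h₀⟩ := hcB
        obtain ⟨γ, hγ⟩ := exists_color_of_column (G := fun u => F (u, 2)) h1 eB h₀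
        refine ⟨γ, hsplit γ (color_of_adjacent_column (G := fun u => F (u, 2))
          (C := fun j => B (j - 1)) h1 (fun j ha hb => ?_) (fun j ha hb => ?_) (j₀ := j₀ + 1)
          (fun j hj => h₀ _ fun h => hj (by rw [← h]; ring)) (fun j => hγ _)) hγ⟩
        · have := eBA' (j - 1) hb
          rw [sub_add_cancel] at this
          exact (this ha).symm
        · rw [add_sub_cancel_right] at hb ⊢
          exact (eBA j hb ha).symm
      · obtain ⟨j, j', hj, ha, ha'⟩ := exists_pair_of_not hcA
        obtain ⟨k, k', -, hb, -⟩ := exists_pair_of_not hcB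
        have := three_le_card ha ha' hb (hA.ne hj) (hAB _ _) (hAB _ _)
        omega
  obtain ⟨γ, hγ⟩ := hcol
  refine Finset.eq_empty_of_forall_notMem ?_
  rintro ⟨j, i⟩ hx
  have n1 : j - 1 ≠ j := fun h => h1 (by linear_combination -h)
  have n2 : j + 1 ≠ j := fun h => h1 (by linear_combination h)
  have n3 : j - 1 ≠ j + 1 := fun h => h2 (by linear_combination -h)
  have e0 := hF.exists_neighbour hγ hx 0
  have e1 := hF.exists_neighbour hγ hx 1
  fin_cases i
  · change A (j - 1) ∈ X ∨ B j ∈ X at e0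
    change B (j - 1) ∈ X ∨ A (j + 1) ∈ X at e1
    change A j ∈ X at hx
    have : 3 ≤ X.card := by
      rcases e0 with e0 | e0 <;> rcases e1 with e1 | e1
      · exact three_le_card hx e0 e1 (hA.ne n1.symm) (hAB _ _) (hAB _ _)
      · exact three_le_card hx e0 e1 (hA.ne n1.symm) (hA.ne n2.symm) (hA.ne n3)
      · exact three_le_card hx e0 e1 (hAB _ _) (hAB _ _) (hB.ne n1.symm)
      · exact three_le_card hx e0 e1 (hAB _ _) (hA.ne n2.symm) (hAB _ _).symm
    omega
  · change A j ∈ X ∨ B (j + 1) ∈ X at e0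
    change B (j - 1) ∈ X ∨ A (j + 1) ∈ X at e1
    change B j ∈ X at hx
    have : 3 ≤ X.card := by
      rcases e0 with e0 | e0 <;> rcases e1 with e1 | e1
      · exact three_le_card hx e0 e1 (hAB _ _).symm (hB.ne n1.symm) (hAB _ _)
      · exact three_le_card hx e0 e1 (hAB _ _).symm (hAB _ _).symm (hA.ne n2.symm)
      · exact three_le_card hx e0 e1 (hB.ne n2.symm) (hB.ne n1.symm) (hB.ne n3.symm)
      · exact three_le_card hx e0 e1 (hB.ne n2.symm) (hAB _ _).symm (hAB _ _).symm
    omega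

/-- In the closed braid on four strands, the crossings outside of `X` lie in one part of a cut at
`X`, if `X` is too small to separate the inner column of crossings from the outer one. -/
lemma exists_color_of_isCut_three (h1 : (1 : ZMod q) ≠ 0) (h2 : (2 : ZMod q) ≠ 0)
    {X : Finset (ZMod q × Fin 3)} {F : (ZMod q × Fin 3) × Fin 4 → ZMod 2}
    (hF : (closedBraidMap 3 q).IsCut X F) (hX : X.card ≤ 3)
    (h3 : (3 : ZMod q) ≠ 0 ∨ X.card ≤ 2) : ∃ γ, ∀ u, u ∉ X → F (u, 2) = γ := by
  let A : ZMod q → ZMod q × Fin 3 := fun j => (j, 0)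
  let B : ZMod q → ZMod q × Fin 3 := fun j => (j, 1)
  -- the shift makes the roles of the inner and the outer column symmetric
  let C : ZMod q → ZMod q × Fin 3 := fun j => (j - 1, 2)
  have hA : Function.Injective A := fun j j' h => congrArg Prod.fst h
  have hB : Function.Injective B := fun j j' h => congrArg Prod.fst h
  have hC : Function.Injective C := fun j j' h => sub_left_injective (congrArg Prod.fst h)
  have hAB : ∀ j j', A j ≠ B j' := fun j j' => by simp [A, B]
  have hCB : ∀ j j', C j ≠ B j' := fun j j' => by simp [C, B]
  have hAC : ∀ j j', A j ≠ C j' := fun j j' => by simp [A, C]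
  have eA : ∀ j, A j ∉ X → A (j + 1) ∉ X → F (A j, 2) = F (A (j + 1), 2) := fun j =>
    hF.eq_of_opp (k := 3) (k' := 0) rfl
  have eC : ∀ j, C j ∉ X → C (j + 1) ∉ X → F (C j, 2) = F (C (j + 1), 2) := fun j =>
    hF.eq_of_opp (k := 2) (k' := 1) (show ((j - 1 + 1, 2), 1) = (C (j + 1), 1) by
      simp only [C]; rw [sub_add_cancel, add_sub_cancel_right])
  have eBA : ∀ j, B j ∉ X → A j ∉ X → F (B j, 2) = F (A j, 2) := fun j =>
    hF.eq_of_opp (k := 0) (k' := 2) rfl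
  have eBA' : ∀ j, B j ∉ X → A (j + 1) ∉ X → F (B j, 2) = F (A (j + 1), 2) := fun j =>
    hF.eq_of_opp (k := 3) (k' := 1) rfl
  have eBC : ∀ j, B j ∉ X → C j ∉ X → F (B j, 2) = F (C j, 2) := fun j =>
    hF.eq_of_opp (k := 1) (k' := 3) rfl
  have eBC' : ∀ j, B j ∉ X → C (j + 1) ∉ X → F (B j, 2) = F (C (j + 1), 2) := fun j =>
    hF.eq_of_opp (k := 2) (k' := 0) (show ((j, 2), 0) = (C (j + 1), 0) by
      simp only [C]; rw [add_sub_cancel_right])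
  have hsplit : ∀ γ, (∀ j, (A j ∉ X → F (A j, 2) = γ) ∧ (B j ∉ X → F (B j, 2) = γ) ∧
      (C j ∉ X → F (C j, 2) = γ)) → ∀ u, u ∉ X → F (u, 2) = γ := by
    rintro γ h ⟨j, i⟩
    fin_cases i
    · exact (h j).1
    · exact (h j).2.1
    · have := (h (j + 1)).2.2
      simp only [C, add_sub_cancel_right] at this
      exact this
  by_cases hcC : ∃ j₀, ∀ j, j ≠ j₀ → C j ∉ X
  · obtain ⟨j₀, h₀⟩ := hcC
    obtain ⟨γ, hγ⟩ := exists_color_of_three_columns (G := fun u => F (u, 2)) h1 h2 hX h3 hA hB hAB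
      eA eC eBA eBA' eBC eBC' h₀
    exact ⟨γ, hsplit γ hγ⟩
  · by_cases hcA : ∃ j₀, ∀ j, j ≠ j₀ → A j ∉ X
    · obtain ⟨j₀, h₀⟩ := hcA
      obtain ⟨γ, hγ⟩ := exists_color_of_three_columns (G := fun u => F (u, 2)) h1 h2 hX h3 hC hB hCB
        eC eA eBC eBC' eBA eBA' h₀
      exact ⟨γ, hsplit γ fun j => ⟨(hγ j).2.2, (hγ j).2.1, (hγ j).1⟩⟩
    · obtain ⟨j, j', hj, ha, ha'⟩ := exists_pair_of_not hcA
      obtain ⟨k, k', hk, hc, hc'⟩ := exists_pair_of_not hcC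
      have := four_le_card ha ha' hc hc' (hA.ne hj) (hAC _ _) (hAC _ _) (hAC _ _) (hAC _ _)
        (hC.ne hk)
      omega

/-- The neighbours in `X` of a crossing in `X`, for a small cut of the closed braid on four
strands. -/
lemma neighbours_of_isCut_three (h1 : (1 : ZMod q) ≠ 0) (h2 : (2 : ZMod q) ≠ 0)
    {X : Finset (ZMod q × Fin 3)} {F : (ZMod q × Fin 3) × Fin 4 → ZMod 2}
    (hF : (closedBraidMap 3 q).IsCut X F) (hX : X.card ≤ 3)
    (h3 : (3 : ZMod q) ≠ 0 ∨ X.card ≤ 2) (j : ZMod q) :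
    ((j, 0) ∈ X → ((j - 1, 0) ∈ X ∨ (j, 1) ∈ X) ∧ ((j - 1, 1) ∈ X ∨ (j + 1, 0) ∈ X)) ∧
    ((j, 1) ∈ X → ((j, 0) ∈ X ∨ (j, 2) ∈ X) ∧ ((j - 1, 2) ∈ X ∨ (j + 1, 0) ∈ X)) ∧
    ((j, 2) ∈ X → ((j, 1) ∈ X ∨ (j + 1, 2) ∈ X) ∧ ((j - 1, 2) ∈ X ∨ (j + 1, 1) ∈ X)) := by
  obtain ⟨γ, hγ⟩ := exists_color_of_isCut_three h1 h2 hF hX h3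
  exact ⟨fun h => ⟨hF.exists_neighbour hγ h 0, hF.exists_neighbour hγ h 1⟩,
    fun h => ⟨hF.exists_neighbour hγ h 0, hF.exists_neighbour hγ h 1⟩,
    fun h => ⟨hF.exists_neighbour hγ h 0, hF.exists_neighbour hγ h 1⟩⟩

/-- The closed braid on four strands has no cut at one or two crossings, unless it has bigons. -/
lemma eq_empty_of_isCut_three (h1 : (1 : ZMod q) ≠ 0) (h2 : (2 : ZMod q) ≠ 0)
    {X : Finset (ZMod q × Fin 3)} {F : (ZMod q × Fin 3) × Fin 4 → ZMod 2}
    (hF : (closedBraidMap 3 q).IsCut X F) (hX : X.card ≤ 2) : X = ∅ := by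
  refine Finset.eq_empty_of_forall_notMem ?_
  rintro ⟨j, i⟩ hx
  obtain ⟨N0, N1, N2⟩ := neighbours_of_isCut_three h1 h2 hF (by omega) (Or.inr hX) j
  have n1 : j ≠ j - 1 := fun h => h1 (by linear_combination h)
  have n2 : j ≠ j + 1 := fun h => h1 (by linear_combination -h)
  have n3 : j - 1 ≠ j + 1 := fun h => h2 (by linear_combination -h)
  have : 3 ≤ X.card := by
    fin_cases i
    · obtain ⟨e0 | e0, e1 | e1⟩ := N0 hx <;>
        exact three_le_card hx e0 e1 (by simp [n1]) (by simp [n1, n2]) (by simp [n1, n3])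
    · obtain ⟨e0 | e0, e1 | e1⟩ := N1 hx <;>
        exact three_le_card hx e0 e1 (by simp) (by simp [n1, n2]) (by simp [n1, n2])
    · obtain ⟨e0 | e0, e1 | e1⟩ := N2 hx <;>
        exact three_le_card hx e0 e1 (by simp [n2]) (by simp [n1, n2]) (by simp [n3.symm, n2])
  omega

lemma subset_of_mem_of_card_le {V : Type*} {X : Finset V} (hX : X.card ≤ 3) {x y z : V}
    (hx : x ∈ X) (hy : y ∈ X) (hz : z ∈ X) (hxy : x ≠ y) (hxz : x ≠ z) (hyz : y ≠ z) {w : V}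
    (hw : w ∈ X) : w = x ∨ w = y ∨ w = z := by
  by_contra h
  simp only [not_or] at h
  have := four_le_card hx hy hz hw hxy hxz hyz (Ne.symm h.1) (Ne.symm h.2.1) (Ne.symm h.2.2)
  omega

/-- A cut of the closed braid on four strands at three crossings is the boundary of a triangular
region. -/
lemma triangle_of_isCut_three (h1 : (1 : ZMod q) ≠ 0) (h2 : (2 : ZMod q) ≠ 0)
    (h3 : (3 : ZMod q) ≠ 0) {X : Finset (ZMod q × Fin 3)}
    {F : (ZMod q × Fin 3) × Fin 4 → ZMod 2} (hF : (closedBraidMap 3 q).IsCut X F)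
    (hX : X.card ≤ 3) (hne : X.Nonempty) :
    ∃ j, (j, 1) ∈ X ∧ ((∀ w ∈ X, w = (j, 1) ∨ w = (j, 0) ∨ w = (j + 1, 0)) ∨
      ∀ w ∈ X, w = (j, 1) ∨ w = (j, 2) ∨ w = (j - 1, 2)) := by
  have N := neighbours_of_isCut_three h1 h2 hF hX (Or.inl h3)
  have n1 : ∀ j : ZMod q, j ≠ j - 1 := fun j h => h1 (by linear_combination h)
  have n2 : ∀ j : ZMod q, j ≠ j + 1 := fun j h => h1 (by linear_combination -h)
  have n3 : ∀ j : ZMod q, j - 1 ≠ j + 1 := fun j h => h2 (by linear_combination -h)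
  have n4 : ∀ j : ZMod q, j + 1 + 1 ≠ j - 1 := fun j h => h3 (by linear_combination h)
  have n5 : ∀ j : ZMod q, j + 1 + 1 ≠ j := fun j h => h2 (by linear_combination h)
  have hsub := @subset_of_mem_of_card_le _ X hX
  by_cases hmid : ∃ j, (j, 1) ∈ X
  · obtain ⟨j, hj⟩ := hmid
    refine ⟨j, hj, ?_⟩
    obtain ⟨e0 | e0, e1 | e1⟩ := (N j).2.1 hj
    · -- the crossings `(j, 0)` and `(j - 1, 2)` are not adjacent
      exfalso
      have hs := fun w => @hsub _ _ _ hj e0 e1 (by simp) (by simp) (by simp) w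
      rcases ((N j).1 e0).2 with e | e
      · have := hs _ e; simp [(n1 j).symm] at this
      · have := hs _ e; simp [(n2 j).symm] at this
    · exact Or.inl fun w => hsub hj e0 e1 (by simp) (by simp) (by simp [n2])
    · exact Or.inr fun w => hsub hj e0 e1 (by simp) (by simp) (by simp [n1])
    · exfalso
      have hs := fun w => @hsub _ _ _ hj e0 e1 (by simp) (by simp) (by simp) w
      rcases ((N j).2.2 e0).2 with e | e
      · have := hs _ e; simp [(n1 j).symm] at this
      · have := hs _ e; simp [(n2 j).symm] at this
  · -- otherwise three consecutive crossings of an outer column would have to close up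
    exfalso
    simp only [not_exists] at hmid
    obtain ⟨⟨j, i⟩, hx⟩ := hne
    fin_cases i
    · have a := ((N j).1 hx).1.resolve_right (hmid _)
      have b := ((N j).1 hx).2.resolve_left (hmid _)
      have c := ((N (j + 1)).1 b).2.resolve_left (hmid _)
      have := hsub hx a b (by simp [n1]) (by simp [n2]) (by simp [n3]) c
      simp [n4, n5, h1] at this
    · exact hmid j hx
    · have a := ((N j).2.2 hx).2.resolve_right (hmid _)
      have b := ((N j).2.2 hx).1.resolve_left (hmid _)
      have c := ((N (j + 1)).2.2 b).1.resolve_left (hmid _)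
      have := hsub hx a b (by simp [n1]) (by simp [n2]) (by simp [n3]) c
      simp [n4, n5, h1] at this

end TorusProjection

namespace TorusProjection

open FourValentMap

/-! ### The reductivity of the standard projections -/

lemma val_of_eq_add_natCast {q : ℕ} [NeZero q] {x y : ZMod q} {k : ℕ} (h : y = x + k)
    (hk : k < q) :
    y.val = x.val + k ∨ y.val + q = x.val + k := by
  have hx := ZMod.val_lt x
  rw [h, ZMod.val_add, ZMod.val_natCast_of_lt hk]
  rcases Nat.lt_or_ge (x.val + k) q with h | h
  · exact Or.inl (Nat.mod_eq_of_lt h)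
  · right
    rw [Nat.mod_eq_sub_mod h, Nat.mod_eq_of_lt (by omega)]
    omega

lemma natCast_ne_zero {q k : ℕ} (hk : 0 < k) (hkq : k < q) : (k : ZMod q) ≠ 0 := fun h => by
  rw [ZMod.natCast_eq_zero_iff] at h
  exact absurd (Nat.le_of_dvd hk h) (by omega)

lemma timeRight_eq {m q : ℕ} {t j : ZMod q} {i : Fin m} {k A : ℕ} (hi : (i : ℕ) = k)
    (h : t * j = A) (hA : A < q) : timeRight m q t (j, i) = 2 * m * A + k := by
  rw [timeRight, h, ZMod.val_natCast_of_lt hA, hi]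

lemma timeLeft_eq {m q : ℕ} {t j : ZMod q} {i : Fin m} {k A : ℕ} (hi : (i : ℕ) = k)
    (h : t * (j + (k : ZMod q) - (m : ZMod q)) = A) (hA : A < q) :
    timeLeft m q t (j, i) = 2 * m * A + (2 * m - 1 - k) := by
  rw [timeLeft]
  dsimp only
  rw [hi, h, ZMod.val_natCast_of_lt hA]

section Times

variable {m q : ℕ} [NeZero q] {t : ZMod q}

/-- Without cuts at one or two crossings, a single operation does not suffice. -/
lemma not_isolatedAfter_of_forall_isCut (ht : t * (m + 1 : ℕ) = 1)
    (hcut : ∀ (X : Finset (ZMod q × Fin m)) (F : (ZMod q × Fin m) × Fin 4 → ZMod 2),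
      (closedBraidMap m q).IsCut X F → X.card ≤ 2 → X = ∅) (j : ℕ) (hj : j < 2) :
    ¬ IsolatedAfter j Set.univ (interlace m q t) := by
  intro h
  obtain ⟨X, hne, -, hcard, hX, -⟩ := h.exists_finset (interlace_symm ht)
  obtain ⟨F, hF⟩ := (isInterlacement ht).exists_isCut (X := X) fun u hu => hX u trivial hu
  exact hne.ne_empty (hcut X F hF (by omega))

/-- The crossings `v`, `x` and `y` are the corners of a triangle in which the curve runs from `v` to
`x` at the times `0` and `1`, from `v` to `y` at the times `M - 1` and `M`, and from `x` to `y` at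
the times `K - 1` and `K`. -/
structure IsTriangle (t : ZMod q) (v x y : ZMod q × Fin m) (M K : ℕ) : Prop where
  right_v : timeRight m q t v = 0
  left_v : timeLeft m q t v + 1 = M
  right_x : timeRight m q t x = 1
  left_x : timeLeft m q t x + 1 = K
  right_y : timeRight m q t y = M
  left_y : timeLeft m q t y = K

/-- Every other crossing is interlaced with an even number of the corners of a triangle. -/
lemma IsTriangle.interlace_add_eq_zero (ht : t * (m + 1 : ℕ) = 1) {v x y : ZMod q × Fin m}
    {M K : ℕ} (h : IsTriangle t v x y M K) {u : ZMod q × Fin m} (huv : u ≠ v) (hux : u ≠ x) :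
    interlace m q t v u + interlace m q t x u + interlace m q t y u = 0 := by
  obtain ⟨hv1, hv2, hx1, hx2, hy1, hy2⟩ := h
  have key : ∀ s, s ≠ timeRight m q t v → s ≠ timeLeft m q t v → s ≠ timeLeft m q t x →
      passages m q t v s + passages m q t x s + passages m q t y s = 0 := by
    intro s h1 h2 h3
    have e1 : timeRight m q t v ≤ s ↔ timeRight m q t x ≤ s := by omega
    have e2 : timeLeft m q t v ≤ s ↔ timeRight m q t y ≤ s := by omega
    have e3 : timeLeft m q t x ≤ s ↔ timeLeft m q t y ≤ s := by omega
    simp only [passages, e1, e2, e3]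
    generalize (if timeRight m q t x ≤ s then (1 : ZMod 2) else 0) = a
    generalize (if timeRight m q t y ≤ s then (1 : ZMod 2) else 0) = b
    generalize (if timeLeft m q t y ≤ s then (1 : ZMod 2) else 0) = c
    revert a b c; decide
  have k1 := key (timeRight m q t u) ((timeRight_injective ht).ne huv)
    (timeRight_ne_timeLeft t u v) (timeRight_ne_timeLeft t u x)
  have k2 := key (timeLeft m q t u) (timeRight_ne_timeLeft t v u).symm
    ((timeLeft_injective ht).ne huv) ((timeLeft_injective ht).ne hux)
  simp only [interlace]
  linear_combination k1 + k2

/-- If the curve passes through the corners of a triangle in the order `v, x, v, y, x, y`, then two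
operations suffice. -/
lemma IsTriangle.isolatedAfter_two (ht : t * (m + 1 : ℕ) = 1) {v x y : ZMod q × Fin m} {M K : ℕ}
    (h : IsTriangle t v x y M K) (hM : 3 ≤ M) (hMK : M + 1 < K) :
    IsolatedAfter 2 Set.univ (interlace m q t) := by
  have hxv : x ≠ v := fun e => by have := h.right_v; rw [← e, h.right_x] at this; omega
  have hyv : y ≠ v := fun e => by have := h.right_v; rw [← e, h.right_y] at this; omega
  have hyx : y ≠ x := fun e => by have := h.right_x; rw [← e, h.right_y] at this; omega
  have heven := fun u (_ : u ∈ Set.univ) huv hux (_ : u ≠ y) =>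
    h.interlace_add_eq_zero ht (u := u) huv hux
  obtain ⟨hv1, hv2, hx1, hx2, hy1, hy2⟩ := h
  refine isolatedAfter_two_of_path (Set.mem_univ v) (Set.mem_univ x) (Set.mem_univ y) hxv hyv hyx
    ?_ ?_ ?_ heven <;> simp only [interlace, passages] <;> split_ifs <;> first | rfl | omega

/-- If the curve passes through the corners of a triangle and a further crossing `u` in the order
`v, x, u, x, y, u, v, y`, then three operations suffice: the first one, at `u`, makes `x` and `y`
interlaced. -/
lemma IsTriangle.isolatedAfter_three (ht : t * (m + 1 : ℕ) = 1) {v x y u : ZMod q × Fin m}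
    {M K : ℕ} (h : IsTriangle t v x y M K) (hu1 : 1 < timeRight m q t u)
    (hu2 : timeRight m q t u + 1 < K) (hu3 : K < timeLeft m q t u)
    (hu4 : timeLeft m q t u + 1 < M) : IsolatedAfter 3 Set.univ (interlace m q t) := by
  have hxv : x ≠ v := fun e => by have := h.right_v; rw [← e, h.right_x] at this; omega
  have hyv : y ≠ v := fun e => by have := h.right_v; rw [← e, h.right_y] at this; omega
  have hyx : y ≠ x := fun e => by have := h.right_x; rw [← e, h.right_y] at this; omega
  have hvu : v ≠ u := fun e => by rw [← e, h.right_v] at hu1; omega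
  have hxu : x ≠ u := fun e => by rw [← e, h.right_x] at hu1; omega
  have hyu : y ≠ u := fun e => by rw [← e, h.right_y] at hu2; omega
  have heven := fun w huv hux => h.interlace_add_eq_zero ht (u := w) huv hux
  obtain ⟨hv1, hv2, hx1, hx2, hy1, hy2⟩ := h
  have ayv : interlace m q t y v = 1 := by
    simp only [interlace, passages]; split_ifs <;> first | rfl | omega
  have axv : interlace m q t x v = 0 := by
    simp only [interlace, passages]; split_ifs <;> first | rfl | omega
  have axy : interlace m q t x y = 0 := by
    simp only [interlace, passages]; split_ifs <;> first | rfl | omega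
  have auv : interlace m q t u v = 0 := by
    simp only [interlace, passages]; split_ifs <;> first | rfl | omega
  have auy : interlace m q t u y = 1 := by
    simp only [interlace, passages]; split_ifs <;> first | rfl | omega
  have axu : interlace m q t x u = 1 := by
    simp only [interlace, passages]; split_ifs <;> first | rfl | omega
  refine ⟨u, trivial, isolatedAfter_two_of_path (x := v) (y := y) (z := x) ⟨trivial, hvu⟩
    ⟨trivial, hyu⟩ ⟨trivial, hxu⟩ hyv hxv hyx.symm ?_ ?_ ?_ ?_⟩
  · rw [localComplement, ayv, auv, mul_zero, add_zero]
  · rw [localComplement, axv, auv, mul_zero, add_zero]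
  · rw [localComplement, axy, axu, auy]; rfl
  · intro w _ hwv _ hwx
    simp only [localComplement]
    linear_combination heven w hwv hwx +
      interlace m q t u w * heven u hvu.symm hxu.symm

end Times

/-- Two operations suffice on three strands for `q = 3 n - 1`. -/
lemma isolatedAfter_three_strands {n : ℕ} (hn : 1 ≤ n) [NeZero (3 * n - 1)]
    (h3 : (3 * n : ZMod (3 * n - 1)) = 1)
    (ht : (n : ZMod (3 * n - 1)) * ((2 + 1 : ℕ) : ZMod (3 * n - 1)) = 1) :
    IsolatedAfter 2 Set.univ (interlace 2 (3 * n - 1) (n : ZMod (3 * n - 1))) := by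
  have hn1 : ((n - 1 : ℕ) : ZMod (3 * n - 1)) = n - 1 := by rw [Nat.cast_sub hn, Nat.cast_one]
  have hn2 : ((2 * n - 1 : ℕ) : ZMod (3 * n - 1)) = 2 * n - 1 := by
    rw [Nat.cast_sub (by omega)]; push_cast; rfl
  have tri : IsTriangle (m := 2) (n : ZMod (3 * n - 1)) (0, 0) (0, 1) (1, 0) (4 * n)
      (8 * n - 1) := by
    constructor
    · rw [timeRight_eq (k := 0) (A := 0) rfl (by simp) (by omega)]
    · rw [timeLeft_eq (k := 0) (A := n - 1) rfl (by rw [hn1]; push_cast; linear_combination -h3)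
        (by omega)]
      omega
    · rw [timeRight_eq (k := 1) (A := 0) rfl (by simp) (by omega)]
    · rw [timeLeft_eq (k := 1) (A := 2 * n - 1) rfl (by rw [hn2]; push_cast; linear_combination -h3)
        (by omega)]
      omega
    · rw [timeRight_eq (k := 0) (A := n) rfl (mul_one _) (by omega)]
      omega
    · rw [timeLeft_eq (k := 0) (A := 2 * n - 1) rfl (by rw [hn2]; push_cast; linear_combination -h3)
        (by omega)]
      omega
  exact tri.isolatedAfter_two ht (by omega) (by omega)

/-- Two operations suffice on four strands for `q = 4 n - 1`. -/
lemma isolatedAfter_four_strands {n : ℕ} (hn : 1 ≤ n) [NeZero (4 * n - 1)]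
    (h4 : (4 * n : ZMod (4 * n - 1)) = 1)
    (ht : (n : ZMod (4 * n - 1)) * ((3 + 1 : ℕ) : ZMod (4 * n - 1)) = 1) :
    IsolatedAfter 2 Set.univ (interlace 3 (4 * n - 1) (n : ZMod (4 * n - 1))) := by
  have hn1 : ((n - 1 : ℕ) : ZMod (4 * n - 1)) = n - 1 := by rw [Nat.cast_sub hn, Nat.cast_one]
  have hn2 : ((2 * n - 1 : ℕ) : ZMod (4 * n - 1)) = 2 * n - 1 := by
    rw [Nat.cast_sub (by omega)]; push_cast; rfl
  have tri : IsTriangle (m := 3) (n : ZMod (4 * n - 1)) (0, 0) (0, 1) (1, 0) (6 * n)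
      (12 * n - 1) := by
    constructor
    · rw [timeRight_eq (k := 0) (A := 0) rfl (by simp) (by omega)]
    · rw [timeLeft_eq (k := 0) (A := n - 1) rfl (by rw [hn1]; push_cast; linear_combination -h4)
        (by omega)]
      omega
    · rw [timeRight_eq (k := 1) (A := 0) rfl (by simp) (by omega)]
    · rw [timeLeft_eq (k := 1) (A := 2 * n - 1) rfl (by rw [hn2]; push_cast; linear_combination -h4)
        (by omega)]
      omega
    · rw [timeRight_eq (k := 0) (A := n) rfl (mul_one _) (by omega)]
      omega
    · rw [timeLeft_eq (k := 0) (A := 2 * n - 1) rfl (by rw [hn2]; push_cast; linear_combination -h4)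
        (by omega)]
      omega
  exact tri.isolatedAfter_two ht (by omega) (by omega)

/-- Three operations suffice on four strands for `q = 4 n + 1`. -/
lemma isolatedAfter_three_four_strands {n : ℕ} (hn : 1 ≤ n)
    (h4 : (4 * n + 1 : ZMod (4 * n + 1)) = 0)
    (ht : ((3 * n + 1 : ℕ) : ZMod (4 * n + 1)) * ((3 + 1 : ℕ) : ZMod (4 * n + 1)) = 1) :
    IsolatedAfter 3 Set.univ
      (interlace 3 (4 * n + 1) ((3 * n + 1 : ℕ) : ZMod (4 * n + 1))) := by
  have tri : IsTriangle (m := 3) ((3 * n + 1 : ℕ) : ZMod (4 * n + 1)) (0, 0) (0, 1) (1, 0)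
      (18 * n + 6) (12 * n + 5) := by
    constructor
    · rw [timeRight_eq (k := 0) (A := 0) rfl (by simp) (by omega)]
    · rw [timeLeft_eq (k := 0) (A := 3 * n) rfl (by push_cast; linear_combination -3 * h4)
        (by omega)]
      omega
    · rw [timeRight_eq (k := 1) (A := 0) rfl (by simp) (by omega)]
    · rw [timeLeft_eq (k := 1) (A := 2 * n) rfl (by push_cast; linear_combination -2 * h4)
        (by omega)]
      omega
    · rw [timeRight_eq (k := 0) (A := 3 * n + 1) rfl (mul_one _) (by omega)]
      omega
    · rw [timeLeft_eq (k := 0) (A := 2 * n) rfl (by push_cast; linear_combination -2 * h4)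
        (by omega)]
      omega
  -- the first operation is applied at the crossing `(-2, 2)`
  have u1 : timeRight 3 (4 * n + 1) ((3 * n + 1 : ℕ) : ZMod (4 * n + 1)) (-2, 2) = 12 * n + 2 := by
    rw [timeRight_eq (k := 2) (A := 2 * n) rfl (by push_cast; linear_combination -2 * h4)
        (by omega)]
    omega
  have u2 : timeLeft 3 (4 * n + 1) ((3 * n + 1 : ℕ) : ZMod (4 * n + 1)) (-2, 2) = 18 * n + 3 := by
    rw [timeLeft_eq (k := 2) (A := 3 * n) rfl (by push_cast; linear_combination -3 * h4) (by omega)]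
    omega
  exact tri.isolatedAfter_three (u := (-2, 2)) ht (by omega) (by omega) (by omega) (by omega)

/-- For `q = 4 n + 1`, the middle crossing of a triangular region of the projection on four strands
is not interlaced with the other two. -/
lemma interlace_middle_eq_zero {n : ℕ} (hn : 1 ≤ n) (h4 : (4 * n + 1 : ZMod (4 * n + 1)) = 0)
    {t : ZMod (4 * n + 1)} (ht : t = ((3 * n + 1 : ℕ) : ZMod (4 * n + 1))) (j : ZMod (4 * n + 1)) :
    interlace 3 (4 * n + 1) t (j, 1) (j, 0) = 0 ∧
    interlace 3 (4 * n + 1) t (j, 1) (j + 1, 0) = 0 ∧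
    interlace 3 (4 * n + 1) t (j, 1) (j, 2) = 0 ∧
    interlace 3 (4 * n + 1) t (j, 1) (j - 1, 2) = 0 := by
  have ht' : t = 3 * n + 1 := by rw [ht]; push_cast; rfl
  have hx := ZMod.val_lt (t * j)
  have R1 : timeRight 3 (4 * n + 1) t (j, 1) = 6 * (t * j).val + 1 := rfl
  have R0 : timeRight 3 (4 * n + 1) t (j, 0) = 6 * (t * j).val + 0 := rfl
  have R2 : timeRight 3 (4 * n + 1) t (j, 2) = 6 * (t * j).val + 2 := rfl
  have R0' : timeRight 3 (4 * n + 1) t (j + 1, 0) = 6 * (t * (j + 1)).val + 0 := rfl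
  have R2' : timeRight 3 (4 * n + 1) t (j - 1, 2) = 6 * (t * (j - 1)).val + 2 := rfl
  have L1 : timeLeft 3 (4 * n + 1) t (j, 1) =
    6 * (t * (j + ((1 : ℕ) : ZMod _) - ((3 : ℕ) : ZMod _))).val + 4 := rfl
  have L0 : timeLeft 3 (4 * n + 1) t (j, 0) =
    6 * (t * (j + ((0 : ℕ) : ZMod _) - ((3 : ℕ) : ZMod _))).val + 5 := rfl
  have L0' : timeLeft 3 (4 * n + 1) t (j + 1, 0) =
    6 * (t * (j + 1 + ((0 : ℕ) : ZMod _) - ((3 : ℕ) : ZMod _))).val + 5 := rfl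
  have L2 : timeLeft 3 (4 * n + 1) t (j, 2) =
    6 * (t * (j + ((2 : ℕ) : ZMod _) - ((3 : ℕ) : ZMod _))).val + 3 := rfl
  have L2' : timeLeft 3 (4 * n + 1) t (j - 1, 2) =
    6 * (t * (j - 1 + ((2 : ℕ) : ZMod _) - ((3 : ℕ) : ZMod _))).val + 3 := rfl
  have v1 := val_of_eq_add_natCast (x := t * j) (k := 2 * n)
    (y := t * (j + ((1 : ℕ) : ZMod _) - ((3 : ℕ) : ZMod _)))
    (by rw [ht']; push_cast; linear_combination -2 * h4) (by omega)
  have v0 := val_of_eq_add_natCast (x := t * j) (k := 3 * n)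
    (y := t * (j + ((0 : ℕ) : ZMod _) - ((3 : ℕ) : ZMod _)))
    (by rw [ht']; push_cast; linear_combination -3 * h4) (by omega)
  have w0 := val_of_eq_add_natCast (x := t * j) (k := 3 * n + 1) (y := t * (j + 1))
    (by rw [ht']; push_cast; ring) (by omega)
  have e0 : t * (j + 1 + ((0 : ℕ) : ZMod _) - ((3 : ℕ) : ZMod _)) =
    t * (j + ((1 : ℕ) : ZMod _) - ((3 : ℕ) : ZMod _)) := by push_cast; ring
  have v2 := val_of_eq_add_natCast (x := t * j) (k := n)
    (y := t * (j + ((2 : ℕ) : ZMod _) - ((3 : ℕ) : ZMod _)))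
    (by rw [ht']; push_cast; linear_combination -h4) (by omega)
  have e2 : t * (j - 1) = t * (j + ((2 : ℕ) : ZMod _) - ((3 : ℕ) : ZMod _)) := by push_cast; ring
  have e2' : t * (j - 1 + ((2 : ℕ) : ZMod _) - ((3 : ℕ) : ZMod _)) =
    t * (j + ((1 : ℕ) : ZMod _) - ((3 : ℕ) : ZMod _)) := by push_cast; ring
  rw [e0] at L0'
  rw [e2] at R2'
  rw [e2'] at L2'
  have b1 := ZMod.val_lt (t * (j + ((1 : ℕ) : ZMod _) - ((3 : ℕ) : ZMod _)))
  have b0 := ZMod.val_lt (t * (j + ((0 : ℕ) : ZMod _) - ((3 : ℕ) : ZMod _)))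
  have b2 := ZMod.val_lt (t * (j + ((2 : ℕ) : ZMod _) - ((3 : ℕ) : ZMod _)))
  have b0' := ZMod.val_lt (t * (j + 1))
  refine ⟨?_, ?_, ?_, ?_⟩
  · simp only [interlace, passages]
    split_ifs <;> first | rfl | omega
  · simp only [interlace, passages]
    split_ifs <;> first | rfl | omega
  · simp only [interlace, passages]
    split_ifs <;> first | rfl | omega
  · simp only [interlace, passages]
    split_ifs <;> first | rfl | omega

/-- For `q = 4 n + 1`, two operations do not suffice on four strands: the crossings involved would
be the corners of a triangle, none of them isolated among the three. -/
lemma not_isolatedAfter_two {n : ℕ} (hn : 1 ≤ n) (h4 : (4 * n + 1 : ZMod (4 * n + 1)) = 0)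
    (ht : ((3 * n + 1 : ℕ) : ZMod (4 * n + 1)) * ((3 + 1 : ℕ) : ZMod (4 * n + 1)) = 1) :
    ¬ IsolatedAfter 2 Set.univ
      (interlace 3 (4 * n + 1) ((3 * n + 1 : ℕ) : ZMod (4 * n + 1))) := by
  have h1 : (1 : ZMod (4 * n + 1)) ≠ 0 := by
    exact_mod_cast natCast_ne_zero (k := 1) (by omega) (by omega)
  have h2 : (2 : ZMod (4 * n + 1)) ≠ 0 := by
    exact_mod_cast natCast_ne_zero (k := 2) (by omega) (by omega)
  have h3 : (3 : ZMod (4 * n + 1)) ≠ 0 := by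
    exact_mod_cast natCast_ne_zero (k := 3) (by omega) (by omega)
  intro h
  obtain ⟨X, hne, -, hcard, hX, hnb⟩ := h.exists_finset (interlace_symm ht)
  obtain ⟨F, hF⟩ := (isInterlacement ht).exists_isCut (X := X) fun u hu => hX u trivial hu
  have hX3 : X.card = 3 := by
    by_contra hc
    exact hne.ne_empty (eq_empty_of_isCut_three h1 h2 hF (by omega))
  obtain ⟨j, hj, hsub⟩ := triangle_of_isCut_three h1 h2 h3 hF hcard hne
  obtain ⟨y, hy, hyj, ha⟩ := hnb (by omega) hX3 _ hj
  obtain ⟨z1, z2, z3, z4⟩ := interlace_middle_eq_zero hn h4 rfl j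
  rcases hsub with hs | hs <;> rcases hs y hy with rfl | rfl | rfl <;> simp_all

/-- The projection of the `(3, 2)`-torus knot has bigons and is treated directly. -/
lemma not_isolatedAfter_two_factors (j : ℕ) (hj : j < 2) :
    ¬ IsolatedAfter j Set.univ (interlace 2 2 1) := by
  have h0 : ∀ w, ∃ u, u ≠ w ∧ interlace 2 2 1 w u ≠ 0 := by decide
  have h1 : ∀ v w, w ≠ v → ∃ u, u ≠ v ∧ u ≠ w ∧
    localComplement (interlace 2 2 1) v w u ≠ 0 := by decide
  interval_cases j
  · rintro ⟨w, -, h⟩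
    obtain ⟨u, hu, hne⟩ := h0 w
    exact hne (h u trivial hu)
  · rintro ⟨v, -, w, ⟨-, hw⟩, h⟩
    obtain ⟨u, huv, huw, hne⟩ := h1 v w hw
    exact hne (h u ⟨trivial, huv⟩ huw)

end TorusProjection

open TorusProjection

theorem mainTheorem4 (n : ℕ) (hn : 1 ≤ n) :
    (torusKnotProjection 3 (3 * n - 1) (by norm_num) (by omega)
        (coprime_mul_sub_one (by norm_num) hn)).reductivity = 2 ∧
    (torusKnotProjection 4 (4 * n - 1) (by norm_num) (by omega)
        (coprime_mul_sub_one (by norm_num) hn)).reductivity = 2 ∧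
    (torusKnotProjection 4 (4 * n + 1) (by norm_num) (by omega)
        (coprime_mul_add_one 4 n)).reductivity = 3 := by
  have hne3 : NeZero (3 * n - 1) := ⟨by omega⟩
  have hne4 : NeZero (4 * n - 1) := ⟨by omega⟩
  have h3 : (3 * n : ZMod (3 * n - 1)) = 1 := by
    have := ZMod.natCast_self (3 * n - 1)
    rw [Nat.cast_sub (by omega)] at this
    push_cast at this
    linear_combination this
  have h4 : (4 * n : ZMod (4 * n - 1)) = 1 := by
    have := ZMod.natCast_self (4 * n - 1)
    rw [Nat.cast_sub (by omega)] at this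
    push_cast at this
    linear_combination this
  have h5 : (4 * n + 1 : ZMod (4 * n + 1)) = 0 := by
    have := ZMod.natCast_self (4 * n + 1)
    push_cast at this
    exact this
  have ht3 : (n : ZMod (3 * n - 1)) * ((2 + 1 : ℕ) : ZMod (3 * n - 1)) = 1 := by
    push_cast; linear_combination h3
  have ht4 : (n : ZMod (4 * n - 1)) * ((3 + 1 : ℕ) : ZMod (4 * n - 1)) = 1 := by
    push_cast; linear_combination h4
  have ht5 : ((3 * n + 1 : ℕ) : ZMod (4 * n + 1)) * ((3 + 1 : ℕ) : ZMod (4 * n + 1)) = 1 := by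
    push_cast; linear_combination 3 * h5
  have hnat : ∀ q : ℕ, 3 ≤ q → (1 : ZMod q) ≠ 0 ∧ (2 : ZMod q) ≠ 0 := fun q hq =>
    ⟨by exact_mod_cast natCast_ne_zero (k := 1) (by omega) (by omega),
      by exact_mod_cast natCast_ne_zero (k := 2) (by omega) (by omega)⟩
  refine ⟨?_, ?_, ?_⟩
  · refine reductivity_eq (m := 2) (k := 2) ht3 (isolatedAfter_three_strands hn h3 ht3)
      fun j hj => ?_
    rcases Nat.lt_or_ge n 2 with h | h
    · obtain rfl : n = 1 := by omega
      have := not_isolatedAfter_two_factors j hj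
      rwa [Nat.cast_one]
    · obtain ⟨n1, n2⟩ := hnat (3 * n - 1) (by omega)
      exact not_isolatedAfter_of_forall_isCut ht3
        (fun X F hF hX => eq_empty_of_isCut_two n1 n2 hF hX) j hj
  · obtain ⟨n1, n2⟩ := hnat (4 * n - 1) (by omega)
    exact reductivity_eq (m := 3) (k := 2) ht4 (isolatedAfter_four_strands hn h4 ht4)
      (not_isolatedAfter_of_forall_isCut ht4
        fun X F hF hX => eq_empty_of_isCut_three n1 n2 hF hX)
  · obtain ⟨n1, n2⟩ := hnat (4 * n + 1) (by omega)
    refine reductivity_eq (m := 3) (k := 3) ht5 (isolatedAfter_three_four_strands hn h5 ht5)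
      fun j hj => ?_
    rcases Nat.lt_or_ge j 2 with h | h
    · exact not_isolatedAfter_of_forall_isCut ht5
        (fun X F hF hX => eq_empty_of_isCut_three n1 n2 hF hX) j h
    · obtain rfl : j = 2 := by omega
      exact not_isolatedAfter_two hn h5 ht5
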